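/- Let $a:[0,\infty)\to(0,\infty)$ be log-concave (that is, $\log a$ is concave on $[0,\infty)$), of class $C^2$ on $(0,\infty)$, with $\lim_{t\to\infty}\frac{\log a(t)}{t}=-\infty$, and put $a_n=a(n)$ for $n=0,1,2,\dots$. Let $\phi_0,\phi_1,\dots$ be independent standard complex Gaussian random variables (density $\frac1\pi e^{-|z|^2}$ on $\mathbb{C}$) and let $f(z)=\sum_{n\ge 0}\phi_n a_n z^n$, which is almost surely an entire function. Let $P_H(r)$ be the probability that $f$ has no zeros in $\{|z|\le r\}$, let $p_H(r)=-\log P_H(r)$, and let $$S(r)=2\sum_{n\,:\,\log(a_nr^n)\ge 0}\log(a_nr^n).$$ A measurable set $E\subset[1,\infty)$ has finite logarithmic measure if $\int_E\frac{dt}{t}<\infty$. There exist positive absolute constants $c_1,c_2$ with the following property. If, for some $\alpha\ge1$, $a(t)\ge\exp(-t\log^{\alpha}t)$ for all sufficiently large $t$, where $\log^\alpha t=(\log t)^\alpha$, then for every $\varepsilon>0$ there is a (deterministic) set $E\subset[1,\infty)$ of finite logarithmic measure, depending only on the function $a$ and on $\varepsilon$, such that for all $r\ge1$ with $r\notin E$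 we have $P_H(r)>0$ and $$S(r)-c_1\,S(r)^{0.9+\varepsilon}\;\le\;p_H(r)\;\le\;S(r)+c_2\,S(r)^{0.5+\varepsilon}.$$ -/

import Mathlib

open MeasureTheory ProbabilityTheory Filter Set
open scoped Topology

noncomputable section

/-- The standard complex Gaussian law: density `π⁻¹ exp (-|z|²)` with respect to Lebesgue measure
on `ℂ`. -/
def stdComplexGaussian : Measure ℂ :=
  (volume : Measure ℂ).withDensity
    (fun z => ENNReal.ofReal (Real.pi⁻¹ * Real.exp (-‖z‖ ^ 2)))

/-- A sequence of independent standard complex Gaussian random variables. -/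
structure IsIIDComplexGaussian {Ω : Type*} [MeasurableSpace Ω] (P : Measure Ω)
    (φ : ℕ → Ω → ℂ) : Prop where
  measurable : ∀ n, Measurable (φ n)
  law : ∀ n, P.map (φ n) = stdComplexGaussian
  indep : iIndepFun φ P

/-- Standing assumptions on the coefficient function `a : [0, ∞) → (0, ∞)` (values at negative
arguments are irrelevant); the coefficients are `a n`, `n = 0, 1, 2, …`. -/
structure IsCoeffFunction (a : ℝ → ℝ) : Prop where
  pos : ∀ t, 0 ≤ t → 0 < a t
  contDiffOn : ContDiffOn ℝ 2 a (Ioi 0)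
  logConcave : ConcaveOn ℝ (Ici 0) (fun t => Real.log (a t))
  tendsto : Tendsto (fun t => Real.log (a t) / t) atTop atBot

/-- The random entire function `f(z) = ∑ φ_n a_n z^n`. -/
def gaussianEntire {Ω : Type*} (a : ℝ → ℝ) (φ : ℕ → Ω → ℂ) (ω : Ω) (z : ℂ) : ℂ :=
  ∑' n : ℕ, φ n ω * (a n : ℂ) * z ^ n

/-- The hole probability: the probability that `f` has no zeros in `{|z| ≤ r}`. -/
def holeProb {Ω : Type*} [MeasurableSpace Ω] (P : Measure Ω) (a : ℝ → ℝ) (φ : ℕ → Ω → ℂ)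
    (r : ℝ) : ℝ :=
  P.real {ω | ∀ z : ℂ, ‖z‖ ≤ r → gaussianEntire a φ ω z ≠ 0}

/-- `p_H(r) = -log P_H(r)` (meaningful when `P_H(r) > 0`). -/
def negLogHoleProb {Ω : Type*} [MeasurableSpace Ω] (P : Measure Ω) (a : ℝ → ℝ) (φ : ℕ → Ω → ℂ)
    (r : ℝ) : ℝ :=
  -Real.log (holeProb P a φ r)

/-- The set of significant indices, `{n : log (a_n r^n) ≥ 0}`. -/
def significantIndices (a : ℝ → ℝ) (r : ℝ) : Set ℕ :=
  {n : ℕ | 0 ≤ Real.log (a n * r ^ n)}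

/-- The set of significant indices is finite, so that the sum defining `S(r)` is a finite sum. -/
theorem significantIndices_finite {a : ℝ → ℝ} (ha : IsCoeffFunction a) {r : ℝ} (hr : 0 < r) :
    (significantIndices a r).Finite := by
  have h1 : ∀ᶠ n : ℕ in atTop, Real.log (a n) / n < -Real.log r :=
    (ha.tendsto.comp tendsto_natCast_atTop_atTop).eventually_lt_atBot (-Real.log r)
  obtain ⟨N, hN⟩ := eventually_atTop.1 h1
  refine (Set.finite_lt_nat (N + 1)).subset fun n hn => ?_
  by_contra hlt
  have hlt' : N + 1 ≤ n := by simpa using hlt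
  have hn0 : (0 : ℝ) < n := by exact_mod_cast (by omega : 0 < n)
  have h2 := (div_lt_iff₀ hn0).1 (hN n (by omega))
  have h3 : Real.log (a n * r ^ n) = Real.log (a n) + n * Real.log r := by
    rw [Real.log_mul (ha.pos n hn0.le).ne' (pow_pos hr n).ne', Real.log_pow]
  have h4 : 0 ≤ Real.log (a n * r ^ n) := hn
  rw [h3] at h4
  nlinarith

/-- `S(r) = 2 ∑ log (a_n r^n)`, the sum being over the significant indices. -/
def bigS (a : ℝ → ℝ) (r : ℝ) : ℝ :=
  2 * ∑ᶠ n ∈ significantIndices a r, Real.log (a n * r ^ n)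

/-- Measurable subsets of `[1, ∞)` of finite logarithmic measure. -/
def FiniteLogMeasure (E : Set ℝ) : Prop :=
  MeasurableSet E ∧ E ⊆ Ici 1 ∧ ∫⁻ t in E, ENNReal.ofReal (1 / t) < ⊤

end

/-! Write `T = S(r)`, `h n = log (a n * r ^ n)`, and let `N` be the largest significant index. Both
bounds on the hole probability have the form `exp (-T)` up to a factor whose logarithm is of order
`N log T`, plus powers `T ^ (O(δ))`; the exceptional set is there to keep `N` close to `T ^ (1/2)`.

Exceptional set: `S` grows in `log r` at rate at least `N ^ 2`. If `N ^ 2 > S ^ (1 + δ)` while `S`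
lies in `[2 ^ k, 2 ^ (k + 1))`, then such radii span a logarithmic length at most `2 ^ (-δ k)`,
which is summable (`exists_finiteLogMeasure`). Off this set, concavity also makes the terms past `N`
decay geometrically, at rate `σ = T ^ (-δ) / 4` (`log_term_le_neg_mul`).

Holes are not too rare (`exp_neg_le_holeProb`): let the constant term dominate by taking `φ 0`
large, the significant coefficients tiny and the remaining ones of controlled growth. Independence
prices this at `T` plus lower-order terms.

Holes are not too frequent (`holeProb_le`): outside an event of probability at most `exp (-T)`, `F z
= f (r z)` is bounded by `exp (2 T)` on the unit disc. If it has no zeros there, `F = exp g` with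
`Re g` bounded above, so Borel–Carathéodory bounds the Taylor coefficients of `g`. Comparing
coefficients in `F' = g' F`, each `c (n + 1)` lies in a disc of polynomially bounded radius about a
point computed from `c 0, …, c n` (`norm_sub_taylorCentre_le`). Conditioning successively, `φ (n +
1)` falls in its disc with probability at most `(D / (a (n + 1) * r ^ (n + 1))) ^ 2`, and the
product over `n < N` is `exp (-T)` up to `D ^ (2 N)` and a constant. -/

section ComplexGaussian

/-! ### The standard complex Gaussian: tails and small discs. -/

theorem stdComplexGaussian_norm_gt {t : ℝ} (ht : 0 ≤ t) :
    stdComplexGaussian {z : ℂ | t < ‖z‖} = ENNReal.ofReal (Real.exp (-t ^ 2)) := by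
  have hmeas : MeasurableSet {z : ℂ | t < ‖z‖} := measurableSet_lt measurable_const measurable_norm
  set F : ℝ → ℝ := (Ioi t).indicator (fun s => Real.pi⁻¹ * Real.exp (-s ^ 2)) with hF
  have hF0 : ∀ s, 0 ≤ F s := fun s => indicator_nonneg (fun s _ => by positivity) s
  have hderiv : ∀ x ∈ Ici t, HasDerivAt (fun s => -(1 / 2) * Real.pi⁻¹ * Real.exp (-s ^ 2))
      (x * (Real.pi⁻¹ * Real.exp (-x ^ 2))) x := by
    intro x _
    have h := (((hasDerivAt_pow 2 x).neg).exp).const_mul (-(1 / 2) * Real.pi⁻¹)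
    convert! h using 1
    simp
    ring
  have hlim : Tendsto (fun s : ℝ => -(1 / 2) * Real.pi⁻¹ * Real.exp (-s ^ 2)) atTop (𝓝 0) := by
    have h : Tendsto (fun s : ℝ => Real.exp (-s ^ 2)) atTop (𝓝 0) :=
      Real.tendsto_exp_neg_atTop_nhds_zero.comp (tendsto_pow_atTop two_ne_zero)
    simpa using h.const_mul (-(1 / 2) * Real.pi⁻¹)
  have hint : IntegrableOn (fun x => x * (Real.pi⁻¹ * Real.exp (-x ^ 2))) (Ioi t) :=
    integrableOn_Ioi_deriv_of_nonneg' hderiv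
      (fun x hx => mul_nonneg (ht.trans (le_of_lt hx)) (by positivity)) hlim
  have hval := integral_Ioi_of_hasDerivAt_of_tendsto' hderiv hint hlim
  have hind : ∀ y, y ^ (Module.finrank ℝ ℂ - 1) • F y =
      (Ioi t).indicator (fun x => x * (Real.pi⁻¹ * Real.exp (-x ^ 2))) y := by
    intro y
    by_cases hy : t < y <;> simp [F, indicator, hy]
  have hintF : Integrable (fun z : ℂ => F ‖z‖) := by
    rw [integrable_fun_norm_addHaar (volume : Measure ℂ)]
    simp_rw [hind]
    exact (hint.integrable_indicator measurableSet_Ioi).integrableOn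
  have hintegral : ∫ z : ℂ, F ‖z‖ = Real.exp (-t ^ 2) := by
    rw [integral_fun_norm_addHaar (volume : Measure ℂ)]
    simp_rw [hind]
    rw [setIntegral_indicator measurableSet_Ioi,
      inter_eq_self_of_subset_right (Ioi_subset_Ioi ht), hval]
    have hball : (volume : Measure ℂ).real (Metric.ball 0 1) = Real.pi := by
      simp [Measure.real, Complex.volume_ball]
    rw [hball]
    simp
    field_simp
  rw [stdComplexGaussian, withDensity_apply _ hmeas, ← hintegral,
    ofReal_integral_eq_lintegral_ofReal hintF (Eventually.of_forall fun z => hF0 _),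
    ← lintegral_indicator hmeas]
  congr 1 with z
  by_cases hz : t < ‖z‖ <;> simp [F, indicator, hz]

/-- The density is at most `π⁻¹`. Uniformity in the centre `w` is what permits a random centre
later. -/
theorem stdComplexGaussian_closedBall_le (w : ℂ) {s : ℝ} (hs : 0 ≤ s) :
    stdComplexGaussian (Metric.closedBall w s) ≤ ENNReal.ofReal (s ^ 2) := by
  rw [stdComplexGaussian, withDensity_apply _ Metric.isClosed_closedBall.measurableSet]
  calc ∫⁻ z in Metric.closedBall w s, ENNReal.ofReal (Real.pi⁻¹ * Real.exp (-‖z‖ ^ 2))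
      ≤ ∫⁻ _ in Metric.closedBall w s, ENNReal.ofReal Real.pi⁻¹ := by
        refine lintegral_mono fun z => ENNReal.ofReal_le_ofReal ?_
        refine mul_le_of_le_one_right (by positivity) (Real.exp_le_one_iff.2 ?_)
        simp
    _ = ENNReal.ofReal (s ^ 2) := by
        rw [setLIntegral_const, Complex.volume_closedBall]
        have : (NNReal.pi : ENNReal) = ENNReal.ofReal Real.pi := by
          rw [← NNReal.coe_real_pi, ENNReal.ofReal_coe_nnreal]
        rw [this, ← ENNReal.ofReal_pow hs, ← ENNReal.ofReal_mul (by positivity),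
          ← ENNReal.ofReal_mul (by positivity)]
        congr 1
        field_simp

instance : IsProbabilityMeasure stdComplexGaussian := by
  constructor
  have h1 := stdComplexGaussian_norm_gt le_rfl
  have h0 : stdComplexGaussian {(0 : ℂ)} = 0 := by
    simpa using stdComplexGaussian_closedBall_le 0 (le_refl (0 : ℝ))
  have hu : (univ : Set ℂ) = {(0 : ℂ)} ∪ {z : ℂ | 0 < ‖z‖} := by
    ext z
    by_cases hz : z = 0 <;> simp [hz]
  rw [hu]
  refine le_antisymm ((measure_union_le _ _).trans ?_) ?_
  · rw [h0, h1]; simp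
  · refine le_trans ?_ (measure_mono subset_union_right)
    rw [h1]; simp

/-- This is `1 - exp (-t²) ≥ t² / (1 + t²)`. The cost `log (1 + t⁻²)` serves both regimes: it is
about `2 log (1 / t)` for small `t`, and at most `t⁻²`, hence summable, for rapidly growing radii.
-/
theorem le_stdComplexGaussian_closedBall {t : ℝ} (ht : 0 < t) :
    ENNReal.ofReal (Real.exp (-(Real.log (1 + (t ^ 2)⁻¹)))) ≤
      stdComplexGaussian (Metric.closedBall 0 t) := by
  have hmeas : MeasurableSet {z : ℂ | t < ‖z‖} := measurableSet_lt measurable_const measurable_norm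
  have hc : Metric.closedBall (0 : ℂ) t = {z : ℂ | t < ‖z‖}ᶜ := by
    ext z; simp
  rw [hc, prob_compl_eq_one_sub hmeas, stdComplexGaussian_norm_gt ht.le, ← ENNReal.ofReal_one,
    ← ENNReal.ofReal_sub _ (by positivity)]
  refine ENNReal.ofReal_le_ofReal ?_
  have hp : 0 < t ^ 2 := by positivity
  rw [Real.exp_neg, Real.exp_log (by positivity), Real.exp_neg]
  have h1 : t ^ 2 + 1 ≤ Real.exp (t ^ 2) := Real.add_one_le_exp _
  have h2 : (Real.exp (t ^ 2))⁻¹ ≤ (t ^ 2 + 1)⁻¹ := inv_anti₀ (by positivity) h1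
  have h3 : (1 + (t ^ 2)⁻¹)⁻¹ = 1 - (t ^ 2 + 1)⁻¹ := by
    field_simp
    ring
  rw [h3]
  linarith

end ComplexGaussian

/-! ### Independence: infinite products and successive conditioning. -/

section Independence

variable {Ω : Type*} [MeasurableSpace Ω] {P : Measure Ω} [IsProbabilityMeasure P]
  {φ : ℕ → Ω → ℂ}

/-- Independence handles finitely many constraints; continuity from above passes to all of them,
since `B` bounds every partial sum. -/
theorem IsIIDComplexGaussian.exp_neg_le_measure_forall (hφ : IsIIDComplexGaussian P φ)
    {G : ℕ → Set ℂ} (hG : ∀ n, MeasurableSet (G n)) {b : ℕ → ℝ} {B : ℝ}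
    (hb : ∀ n, ENNReal.ofReal (Real.exp (-b n)) ≤ stdComplexGaussian (G n))
    (hB : ∀ m, ∑ n ∈ Finset.range m, b n ≤ B) :
    ENNReal.ofReal (Real.exp (-B)) ≤ P {ω | ∀ n, φ n ω ∈ G n} := by
  set s : ℕ → Set Ω := fun m => ⋂ n ∈ Finset.range m, φ n ⁻¹' G n with hs
  have hsm : ∀ m, MeasurableSet (s m) := fun m =>
    Finset.measurableSet_biInter _ fun n _ => hφ.measurable n (hG n)
  have hanti : Antitone s := fun m k hmk =>
    biInter_subset_biInter_left (by
      intro n hn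
      simp only [Finset.coe_range, mem_Iio] at hn ⊢
      omega)
  have hinter : {ω | ∀ n, φ n ω ∈ G n} = ⋂ m, s m := by
    ext ω
    simp only [mem_ofPred_eq, hs, mem_iInter, mem_preimage, Finset.mem_range]
    exact ⟨fun h m n _ => h n, fun h n => h (n + 1) n (Nat.lt_succ_self n)⟩
  rw [hinter]
  refine ge_of_tendsto (tendsto_measure_iInter_atTop (fun i => (hsm i).nullMeasurableSet) hanti
    ⟨0, measure_ne_top _ _⟩) (Eventually.of_forall fun m => ?_)
  have h1 : P (s m) = ∏ n ∈ Finset.range m, stdComplexGaussian (G n) := by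
    rw [hs, hφ.indep.measure_inter_preimage_eq_mul _ (fun n _ => hG n)]
    refine Finset.prod_congr rfl fun n _ => ?_
    rw [← hφ.law n, Measure.map_apply (hφ.measurable n) (hG n)]
  calc ENNReal.ofReal (Real.exp (-B))
      ≤ ENNReal.ofReal (Real.exp (∑ n ∈ Finset.range m, -b n)) := by
        refine ENNReal.ofReal_le_ofReal (Real.exp_le_exp.2 ?_)
        rw [Finset.sum_neg_distrib]
        linarith [hB m]
    _ = ∏ n ∈ Finset.range m, ENNReal.ofReal (Real.exp (-b n)) := by
        rw [Real.exp_sum, ENNReal.ofReal_prod_of_nonneg fun n _ => (Real.exp_pos _).le]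
    _ ≤ ∏ n ∈ Finset.range m, stdComplexGaussian (G n) := Finset.prod_le_prod' fun n _ => hb n
    _ = P (s m) := h1.symm

/-- If `φ n` is confined to a disc of radius `R` whose centre is determined by
`φ 0, …, φ (n - 1)`, this costs at least a factor `R ^ 2` of probability. -/
theorem IsIIDComplexGaussian.measure_inter_closedBall_le (hφ : IsIIDComplexGaussian P φ) (n : ℕ)
    {A : Set (ℕ → ℂ)} (hA : MeasurableSet A)
    (hA' : ∀ u v : ℕ → ℂ, (∀ i < n, u i = v i) → u ∈ A → v ∈ A)
    {ctr : (ℕ → ℂ) → ℂ} (hctr : Measurable ctr)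
    (hctr' : ∀ u v : ℕ → ℂ, (∀ i < n, u i = v i) → ctr u = ctr v) {R : ℝ} (hR : 0 ≤ R) :
    P {ω | (fun i => φ i ω) ∈ A ∧ ‖φ n ω - ctr (fun i => φ i ω)‖ ≤ R} ≤
      P {ω | (fun i => φ i ω) ∈ A} * ENNReal.ofReal (R ^ 2) := by
  set X : Ω → (Finset.range n → ℂ) := fun ω i => φ i ω with hX
  -- Padding by zeros turns the finite past into a full sequence; `A` and `ctr` do not see the
  -- padding.
  set ext : (Finset.range n → ℂ) → (ℕ → ℂ) :=
    fun u i => if h : i ∈ Finset.range n then u ⟨i, h⟩ else 0 with hext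
  have hXm : Measurable X := measurable_pi_lambda _ fun i => hφ.measurable i
  have hextm : Measurable ext := measurable_pi_lambda _ fun i => by
    by_cases h : i ∈ Finset.range n
    · have h1 : Measurable fun u : Finset.range n → ℂ => u ⟨i, h⟩ := measurable_pi_apply _
      simp only [hext, h, dite_true]; exact h1
    · simp only [hext, h, dite_false]; exact measurable_const
  have hag : ∀ ω, ∀ i < n, ext (X ω) i = φ i ω := by
    intro ω i hi
    simp [hext, hX, hi]
  have hind : IndepFun X (φ n) P := by
    have h := hφ.indep.indepFun_finset (Finset.range n) {n} (by simp) hφ.measurable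
    have hψ : Measurable fun v : (({n} : Finset ℕ) → ℂ) => v ⟨n, by simp⟩ := measurable_pi_apply _
    exact h.comp measurable_id hψ
  have hprod := (indepFun_iff_map_prod_eq_prod_map_map hXm.aemeasurable
    (hφ.measurable n).aemeasurable).1 hind
  rw [hφ.law n] at hprod
  have : IsProbabilityMeasure (P.map X) := Measure.isProbabilityMeasure_map hXm.aemeasurable
  set W : Set ((Finset.range n → ℂ) × ℂ) := {p | ext p.1 ∈ A ∧ ‖p.2 - ctr (ext p.1)‖ ≤ R} with hW
  have hWm : MeasurableSet W := by
    have h1 : Measurable fun p : (Finset.range n → ℂ) × ℂ => ‖p.2 - ctr (ext p.1)‖ :=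
      (measurable_snd.sub (hctr.comp (hextm.comp measurable_fst))).norm
    exact ((hextm.comp measurable_fst) hA).inter (measurableSet_le h1 measurable_const)
  have hmem : ∀ ω, (fun i => φ i ω) ∈ A ↔ ext (X ω) ∈ A := fun ω =>
    ⟨hA' _ _ fun i hi => (hag ω i hi).symm, hA' _ _ (hag ω)⟩
  have hL : {ω | (fun i => φ i ω) ∈ A ∧ ‖φ n ω - ctr (fun i => φ i ω)‖ ≤ R} =
      (fun ω => (X ω, φ n ω)) ⁻¹' W := by
    ext ω
    simp only [mem_ofPred_eq, mem_preimage, hW, hmem ω, hctr' _ _ (hag ω)]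
  have hRt : {ω | (fun i => φ i ω) ∈ A} = X ⁻¹' (ext ⁻¹' A) := by
    ext ω
    simp only [mem_ofPred_eq, mem_preimage, hmem ω]
  rw [hL, hRt, ← Measure.map_apply (hXm.prodMk (hφ.measurable n)) hWm, hprod,
    Measure.prod_apply hWm, ← Measure.map_apply hXm (hextm hA)]
  calc ∫⁻ x, stdComplexGaussian (Prod.mk x ⁻¹' W) ∂P.map X
      ≤ ∫⁻ x, (ext ⁻¹' A).indicator (fun _ => ENNReal.ofReal (R ^ 2)) x ∂P.map X := by
        refine lintegral_mono fun x => ?_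
        by_cases hx : x ∈ ext ⁻¹' A
        · rw [indicator_of_mem hx]
          refine (measure_mono fun z hz => ?_).trans
            (stdComplexGaussian_closedBall_le (ctr (ext x)) hR)
          rw [mem_closedBall_iff_norm]
          exact hz.2
        · rw [indicator_of_notMem hx]
          have : Prod.mk x ⁻¹' W = ∅ := by
            ext z
            simp only [mem_preimage, mem_empty_iff_false, iff_false]
            exact fun hz => hx hz.1
          simp [this]
    _ = P.map X (ext ⁻¹' A) * ENNReal.ofReal (R ^ 2) := by
        rw [lintegral_indicator_const (hextm hA), mul_comm]

/-- Condition on the past one variable at a time. The shift by one leaves `φ 0` unconstrained. -/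
theorem IsIIDComplexGaussian.measure_forall_closedBall_le (hφ : IsIIDComplexGaussian P φ)
    {ctr : ℕ → (ℕ → ℂ) → ℂ} (hctr : ∀ n, Measurable (ctr n))
    (hctr' : ∀ n, ∀ u v : ℕ → ℂ, (∀ i ≤ n, u i = v i) → ctr n u = ctr n v) {R : ℕ → ℝ}
    (hR : ∀ n, 0 ≤ R n) (N : ℕ) :
    P {ω | ∀ n < N, ‖φ (n + 1) ω - ctr n (fun i => φ i ω)‖ ≤ R n} ≤
      ENNReal.ofReal (∏ n ∈ Finset.range N, R n ^ 2) := by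
  induction N with
  | zero => simp
  | succ N ih =>
    set A : Set (ℕ → ℂ) := {u | ∀ n < N, ‖u (n + 1) - ctr n u‖ ≤ R n} with hA
    have hAm : MeasurableSet A := by
      have : A = ⋂ n ∈ Finset.range N, {u | ‖u (n + 1) - ctr n u‖ ≤ R n} := by
        ext u; simp [hA]
      rw [this]
      exact Finset.measurableSet_biInter _ fun n _ =>
        measurableSet_le ((measurable_pi_apply (n + 1)).sub (hctr n)).norm measurable_const
    have h := hφ.measure_inter_closedBall_le (N + 1) hAm (fun u v huv hu n hn => by
      rw [← huv (n + 1) (by omega), ← hctr' n u v fun i hi => huv i (by omega)]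
      exact hu n hn) (hctr N) (fun u v huv => hctr' N u v fun i hi => huv i (by omega)) (hR N)
    have hset : {ω | ∀ n < N + 1, ‖φ (n + 1) ω - ctr n (fun i => φ i ω)‖ ≤ R n} =
        {ω | (fun i => φ i ω) ∈ A ∧ ‖φ (N + 1) ω - ctr N (fun i => φ i ω)‖ ≤ R N} := by
      ext ω
      simp only [mem_ofPred_eq, hA, Nat.lt_succ_iff_lt_or_eq]
      exact ⟨fun h => ⟨fun n hn => h n (Or.inl hn), h N (Or.inr rfl)⟩,
        fun h n hn => hn.elim (h.1 n) fun e => e ▸ h.2⟩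
    rw [hset, Finset.prod_range_succ, ENNReal.ofReal_mul (Finset.prod_nonneg fun n _ => sq_nonneg _)]
    exact h.trans (by gcongr; exact ih)

end Independence

/-! ### Taylor coefficients of a nonvanishing function on the unit disc. -/

/-- The Taylor coefficients at `0` of `F' / F` for `F z = ∑ c n * z ^ n`. -/
noncomputable def logDerivCoeff (c : ℕ → ℂ) (n : ℕ) : ℂ :=
  ((n + 1) * c (n + 1) - ∑ i : Fin n, logDerivCoeff c i * c (n - i)) / c 0
decreasing_by exact i.2

/-- The value that `c (n + 1)` would take if the Taylor coefficient of order `n` of `F' / F`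
vanished, in terms of `c 0, …, c n`. -/
noncomputable def taylorCentre (n : ℕ) (c : ℕ → ℂ) : ℂ :=
  (∑ i : Fin n, logDerivCoeff c i * c (n - i)) / (n + 1)

theorem measurable_logDerivCoeff (n : ℕ) : Measurable fun c => logDerivCoeff c n := by
  induction n using Nat.strong_induction_on with
  | _ n ih =>
    have h : (fun c => logDerivCoeff c n) = fun c =>
        ((n + 1) * c (n + 1) - ∑ i : Fin n, logDerivCoeff c i * c (n - i)) / c 0 := by
      ext c; rw [logDerivCoeff]
    rw [h]
    refine Measurable.div (Measurable.sub ((measurable_pi_apply _).const_mul _) ?_)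
      (measurable_pi_apply _)
    exact Finset.measurable_sum _ fun i _ => (ih i i.2).mul (measurable_pi_apply _)

theorem measurable_taylorCentre (n : ℕ) : Measurable (taylorCentre n) := by
  have h : Measurable fun c => ∑ i : Fin n, logDerivCoeff c i * c (n - i) :=
    Finset.measurable_sum _ fun i _ => (measurable_logDerivCoeff i).mul (measurable_pi_apply _)
  exact h.div_const _

theorem logDerivCoeff_congr {n : ℕ} {u v : ℕ → ℂ} (h : ∀ i ≤ n + 1, u i = v i) :
    logDerivCoeff u n = logDerivCoeff v n := by
  induction n using Nat.strong_induction_on with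
  | _ n ih =>
    rw [logDerivCoeff, logDerivCoeff, h (n + 1) le_rfl, h 0 (by omega)]
    congr 2
    refine Finset.sum_congr rfl fun i _ => ?_
    rw [ih i i.2 fun j hj => h j (by omega), h (n - i) (by omega)]

/-- Causality of the centre, as the successive conditioning requires. -/
theorem taylorCentre_congr {n : ℕ} {u v : ℕ → ℂ} (h : ∀ i ≤ n, u i = v i) :
    taylorCentre n u = taylorCentre n v := by
  rw [taylorCentre, taylorCentre]
  congr 1
  refine Finset.sum_congr rfl fun i _ => ?_
  rw [logDerivCoeff_congr fun j hj => h j (by omega), h (n - i) (by omega)]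

theorem iteratedDeriv_zero_of_hasSum {c : ℕ → ℂ} {F : ℂ → ℂ}
    (hF : ∀ z ∈ Metric.ball (0 : ℂ) 1, HasSum (fun n => c n * z ^ n) (F z)) :
    AnalyticOnNhd ℂ F (Metric.ball 0 1) ∧ ∀ n, iteratedDeriv n F 0 = n.factorial * c n := by
  have hp : HasFPowerSeriesOnBall F (FormalMultilinearSeries.ofScalars ℂ c) 0 1 := by
    refine ⟨?_, one_pos, fun {y} hy => ?_⟩
    · refine ENNReal.le_of_forall_nnreal_lt fun r hr => ?_
      have hr1 : (r : ℝ) < 1 := by exact_mod_cast hr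
      have hs := (hF r (by simpa using hr1)).summable.tendsto_atTop_zero
      refine FormalMultilinearSeries.le_radius_of_tendsto _ (l := 0) ?_
      have := hs.norm
      simpa [FormalMultilinearSeries.ofScalars_norm] using! this
    · have hy' : y ∈ Metric.ball (0 : ℂ) 1 := by
        rw [← ENNReal.ofReal_one, Metric.eball_ofReal] at hy
        exact hy
      simpa [FormalMultilinearSeries.ofScalars_apply_eq, mul_comm] using! hF y hy'
  refine ⟨?_, fun n => ?_⟩
  · have h := hp.analyticOnNhd
    rwa [← ENNReal.ofReal_one, Metric.eball_ofReal] at h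
  · have h := hp.factorial_smul 1 n
    rw [iteratedFDeriv_apply_eq_iteratedDeriv_mul_prod, Finset.prod_const_one, one_smul] at h
    rw [← h]
    simp

/-- Borel–Carathéodory for Taylor coefficients. -/
theorem norm_iteratedDeriv_le_of_re_le {g : ℂ → ℂ} (hg : DifferentiableOn ℂ g (Metric.ball 0 1))
    {A : ℝ} (hA : 0 < A) (hre : ∀ z ∈ Metric.ball (0 : ℂ) 1, (g z).re ≤ (g 0).re + A) (n : ℕ) :
    ‖iteratedDeriv (n + 1) g 0‖ ≤ (n + 1).factorial * (12 * A * (n + 1)) := by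
  -- This radius balances the two losses: `1 / (1 - ρ) = n + 2`, while `ρ⁻¹ ^ n` stays below `e`.
  set ρ : ℝ := (n + 1) / (n + 2) with hρ
  have hρ0 : 0 < ρ := by positivity
  have hρ1 : 1 - ρ = 1 / (n + 2) := by rw [hρ]; field_simp; ring
  have hρ2 : ρ < 1 := by
    have : (0 : ℝ) < 1 / (n + 2) := by positivity
    linarith
  have hsub : DifferentiableOn ℂ (fun z => g z - g 0) (Metric.ball 0 1) := hg.sub_const _
  have hbound : ∀ z ∈ Metric.sphere (0 : ℂ) ρ, ‖g z - g 0‖ ≤ 2 * A * ρ / (1 - ρ) := by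
    intro z hz
    have hz' : ‖z‖ = ρ := by simpa using hz
    have h := Complex.borelCaratheodory_zero hA hsub (fun w hw => by
      have := hre w hw
      simp only [mem_ofPred_eq, Complex.sub_re]
      linarith) one_pos (z := z) (by simpa [hz'] using hρ2) (by simp)
    rwa [hz'] at h
  have hcl : DiffContOnCl ℂ (fun z => g z - g 0) (Metric.ball 0 ρ) := by
    refine (hsub.mono ?_).diffContOnCl
    rw [closure_ball _ hρ0.ne']
    exact Metric.closedBall_subset_ball hρ2
  have hC := Complex.norm_iteratedDeriv_le_of_forall_mem_sphere_norm_le (n + 1) hρ0 hcl hbound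
  have hder : iteratedDeriv (n + 1) (fun z => g z - g 0) 0 = iteratedDeriv (n + 1) g 0 := by
    rw [iteratedDeriv_succ', iteratedDeriv_succ']
    congr 1
    ext z
    simp
  rw [hder] at hC
  refine hC.trans ?_
  have hpow : (ρ⁻¹) ^ n ≤ 3 := by
    have h1 : ρ⁻¹ ≤ Real.exp (1 / (n + 1)) := by
      have := Real.add_one_le_exp (1 / ((n : ℝ) + 1))
      refine le_trans (le_of_eq ?_) this
      rw [hρ]; field_simp; ring
    calc (ρ⁻¹) ^ n ≤ (Real.exp (1 / (n + 1))) ^ n := by gcongr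
      _ = Real.exp (n * (1 / (n + 1))) := by rw [← Real.exp_nat_mul]
      _ ≤ Real.exp 1 := by
        refine Real.exp_le_exp.2 ?_
        rw [mul_one_div, div_le_one (by positivity)]
        linarith
      _ ≤ 3 := by linarith [Real.exp_one_lt_d9]
  rw [mul_div_assoc]
  refine mul_le_mul_of_nonneg_left ?_ (by positivity)
  have : 2 * A * ρ / (1 - ρ) / ρ ^ (n + 1) = 2 * A * (n + 2) * (ρ⁻¹) ^ n := by
    rw [hρ1, inv_pow, pow_succ]
    field_simp
  rw [this]
  calc 2 * A * (n + 2) * (ρ⁻¹) ^ n ≤ 2 * A * (n + 2) * 3 := by gcongr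
    _ ≤ 12 * A * (n + 1) := by nlinarith [mul_nonneg hA.le (Nat.cast_nonneg (α := ℝ) n)]

theorem exists_log_of_ne_zero {F : ℂ → ℂ} (hF : DifferentiableOn ℂ F (Metric.ball 0 1))
    (hF0 : ∀ z ∈ Metric.ball (0 : ℂ) 1, F z ≠ 0) :
    ∃ g : ℂ → ℂ, ∀ z ∈ Metric.ball (0 : ℂ) 1,
      HasDerivAt g (deriv F z / F z) z ∧ F z = Complex.exp (g z) := by
  have h0 : (0 : ℂ) ∈ Metric.ball (0 : ℂ) 1 := by simp
  have hq : DifferentiableOn ℂ (fun z => deriv F z / F z) (Metric.ball 0 1) :=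
    (hF.deriv Metric.isOpen_ball).div hF hF0
  obtain ⟨g, hg0, hg⟩ := hq.isExactOn_ball.with_val_at 0 (Complex.log (F 0))
  refine ⟨g, fun z hz => ⟨hg z hz, ?_⟩⟩
  have hd : ∀ w ∈ Metric.ball (0 : ℂ) 1,
      HasDerivAt (fun w => F w * Complex.exp (-g w)) 0 w := by
    intro w hw
    have h1 := (hF.differentiableAt (Metric.isOpen_ball.mem_nhds hw)).hasDerivAt
    have h2 := h1.mul (hg w hw).neg.cexp
    convert! h2 using 1
    field_simp [hF0 w hw]
    ring
  have hconst : F z * Complex.exp (-g z) = F 0 * Complex.exp (-g 0) := by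
    refine Metric.isOpen_ball.is_const_of_deriv_eq_zero (convex_ball (0 : ℂ) 1).isPreconnected
      (fun w hw => (hd w hw).differentiableAt.differentiableWithinAt)
      (fun w hw => (hd w hw).deriv) hz h0
  rw [hg0, Complex.exp_neg, Complex.exp_neg, Complex.exp_log (hF0 0 h0),
    mul_inv_cancel₀ (hF0 0 h0)] at hconst
  field_simp at hconst
  exact hconst

/-- With `F = exp g` and `Q i` the coefficients of `g'`, the identity `F' = g' F` reads `(n + 1) c
(n + 1) = ∑ Q i * c (n - i)`. The terms `i < n` involve only `c 0, …, c n` and form the centre; the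
term `i = n` is `c 0 * Q n`, and `Q n` is bounded because `Re g = log ‖F‖ ≤ L`. -/
theorem norm_sub_taylorCentre_le {c : ℕ → ℂ} {F : ℂ → ℂ}
    (hF : ∀ z ∈ Metric.ball (0 : ℂ) 1, HasSum (fun n => c n * z ^ n) (F z))
    (hF0 : ∀ z ∈ Metric.ball (0 : ℂ) 1, F z ≠ 0) {L : ℝ}
    (hL : ∀ z ∈ Metric.ball (0 : ℂ) 1, ‖F z‖ ≤ Real.exp L) (hc : Real.log ‖c 0‖ < L) (n : ℕ) :
    ‖c (n + 1) - taylorCentre n c‖ ≤ ‖c 0‖ * (12 * (L - Real.log ‖c 0‖) * (n + 1)) := by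
  have h0 : (0 : ℂ) ∈ Metric.ball (0 : ℂ) 1 := by simp
  obtain ⟨hFa, hFc⟩ := iteratedDeriv_zero_of_hasSum hF
  have hFd : DifferentiableOn ℂ F (Metric.ball 0 1) := hFa.differentiableOn
  obtain ⟨g, hg⟩ := exists_log_of_ne_zero hFd hF0
  have hgd : DifferentiableOn ℂ g (Metric.ball 0 1) := fun z hz =>
    (hg z hz).1.differentiableAt.differentiableWithinAt
  have hc0 : F 0 = c 0 := by simpa using hFc 0
  have hc0' : c 0 ≠ 0 := hc0 ▸ hF0 0 h0
  have hre : ∀ z ∈ Metric.ball (0 : ℂ) 1, (g z).re = Real.log ‖F z‖ := by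
    intro z hz
    rw [(hg z hz).2, Complex.norm_exp, Real.log_exp]
  have hB := norm_iteratedDeriv_le_of_re_le hgd (sub_pos.2 hc) (fun z hz => by
    rw [hre z hz, hre 0 h0, hc0]
    have := Real.log_le_log (norm_pos_iff.2 (hF0 z hz)) (hL z hz)
    rw [Real.log_exp] at this
    linarith)
  set Q : ℕ → ℂ := fun i => iteratedDeriv (i + 1) g 0 / i.factorial with hQ
  have hball : Metric.ball (0 : ℂ) 1 ∈ 𝓝 (0 : ℂ) := Metric.isOpen_ball.mem_nhds h0
  have hga : AnalyticAt ℂ g 0 := hgd.analyticAt hball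
  have hrec : ∀ n : ℕ, (n + 1) * c (n + 1) = ∑ i ∈ Finset.range (n + 1), Q i * c (n - i) := by
    intro n
    have h1 : deriv F =ᶠ[𝓝 0] deriv g * F := by
      filter_upwards [hball] with z hz
      rw [Pi.mul_apply, (hg z hz).1.deriv, div_mul_cancel₀ _ (hF0 z hz)]
    have h2 := h1.iteratedDeriv_eq n
    rw [← iteratedDeriv_succ', hFc, iteratedDeriv_mul hga.deriv.contDiffAt
      (hFa 0 h0).contDiffAt] at h2
    have h3 : ∀ i ∈ Finset.range (n + 1),
        (n.choose i : ℂ) * iteratedDeriv i (deriv g) 0 * iteratedDeriv (n - i) F 0 =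
          n.factorial * (Q i * c (n - i)) := by
      intro i hi
      have hin : i ≤ n := by simpa [Nat.lt_succ_iff] using hi
      rw [← iteratedDeriv_succ', hFc, Nat.cast_choose ℂ hin, hQ]
      have := Nat.factorial_ne_zero i
      have := Nat.factorial_ne_zero (n - i)
      field_simp
    rw [Finset.sum_congr rfl h3, ← Finset.mul_sum, Nat.factorial_succ] at h2
    push_cast at h2
    have hn : (n.factorial : ℂ) ≠ 0 := by exact_mod_cast Nat.factorial_ne_zero n
    refine mul_left_cancel₀ hn ?_
    rw [← h2]
    ring
  have hQL : ∀ n, logDerivCoeff c n = Q n := by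
    intro n
    induction n using Nat.strong_induction_on with
    | _ n ih =>
      have h1 : ∑ i ∈ Finset.range n, logDerivCoeff c i * c (n - i) =
          ∑ i ∈ Finset.range n, Q i * c (n - i) :=
        Finset.sum_congr rfl fun i hi => by rw [ih i (Finset.mem_range.1 hi)]
      rw [logDerivCoeff, hrec, Finset.sum_range_succ, ← Finset.sum_range fun i =>
        logDerivCoeff c i * c (n - i), h1]
      simp [hc0']
  have hkey : c (n + 1) - taylorCentre n c = c 0 * (Q n / (n + 1)) := by
    have hn : (n + 1 : ℂ) ≠ 0 := by exact_mod_cast Nat.succ_ne_zero n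
    rw [taylorCentre, ← Finset.sum_range fun i => logDerivCoeff c i * c (n - i)]
    simp_rw [hQL]
    have := hrec n
    rw [Finset.sum_range_succ, Nat.sub_self] at this
    field_simp
    linear_combination this
  rw [hkey, norm_mul]
  refine mul_le_mul_of_nonneg_left ?_ (norm_nonneg _)
  have hn1 : ‖(n + 1 : ℂ)‖ = n + 1 := by
    have : ((n + 1 : ℕ) : ℂ) = (n + 1 : ℂ) := by push_cast; ring
    rw [← this, Complex.norm_natCast]; push_cast; ring
  have hf : (0 : ℝ) < n.factorial := by exact_mod_cast n.factorial_pos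
  rw [hQ, norm_div, norm_div, hn1, Complex.norm_natCast, div_div, div_le_iff₀ (by positivity)]
  refine (hB n).trans (le_of_eq ?_)
  rw [Nat.factorial_succ]
  push_cast
  ring

/-! ### Significant indices and consequences of log-concavity. -/

/-- `N` is the largest significant index, and all indices from `1` to `N` are significant. -/
structure IsLastSignificant (a : ℝ → ℝ) (r : ℝ) (N : ℕ) : Prop where
  one_le : 1 ≤ N
  nonneg : ∀ n ∈ Finset.Icc 1 N, 0 ≤ Real.log (a n * r ^ n)
  neg : ∀ n, N < n → Real.log (a n * r ^ n) < 0

namespace IsCoeffFunction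

variable {a : ℝ → ℝ} {r s : ℝ} {N : ℕ}

theorem log_term (ha : IsCoeffFunction a) (hr : 0 < r) (n : ℕ) :
    Real.log (a n * r ^ n) = Real.log (a n) + n * Real.log r := by
  rw [Real.log_mul (ha.pos n n.cast_nonneg).ne' (pow_pos hr n).ne', Real.log_pow]

theorem concaveOn_log_add (ha : IsCoeffFunction a) (x : ℝ) :
    ConcaveOn ℝ (Ici 0) (fun t => Real.log (a t) + t * x) := by
  refine ha.logConcave.add ⟨convex_Ici 0, fun u _ v _ p q _ _ _ => ?_⟩
  simp only [smul_eq_mul]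
  exact le_of_eq (by ring)

/-- A concave function that is nonnegative at `1` and at `N` is nonnegative in between. Index `0` is
left out because `log (a 0)` may be negative for every `r`. -/
theorem exists_isLastSignificant (ha : IsCoeffFunction a) (hr : 0 < r)
    (h1 : 0 ≤ Real.log (a 1) + Real.log r) : ∃ N, IsLastSignificant a r N := by
  have hfin := significantIndices_finite ha hr
  have hmem1 : 1 ∈ hfin.toFinset := by
    rw [Finite.mem_toFinset]
    change 0 ≤ Real.log (a (1 : ℕ) * r ^ 1)
    rw [ha.log_term hr]
    simpa using h1
  set N := hfin.toFinset.max' ⟨1, hmem1⟩ with hN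
  have hN1 : 1 ≤ N := Finset.le_max' _ _ hmem1
  have hNmem : 0 ≤ Real.log (a N * r ^ N) := by
    have := Finset.max'_mem hfin.toFinset ⟨1, hmem1⟩
    rwa [Finite.mem_toFinset] at this
  refine ⟨N, hN1, fun n hn => ?_, fun n hn => ?_⟩
  · obtain ⟨hn1, hn2⟩ := Finset.mem_Icc.1 hn
    rw [ha.log_term hr] at hNmem ⊢
    have hc := (ha.concaveOn_log_add (Real.log r)).min_le_of_mem_Icc (x := (1 : ℝ)) (y := N) (z := n)
      (by simp) (by simp) ⟨by exact_mod_cast hn1, by exact_mod_cast hn2⟩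
    exact le_trans (le_min (by simpa using h1) hNmem) hc
  · by_contra hlt
    have : n ∈ hfin.toFinset := (Finite.mem_toFinset _).2 (not_lt.1 hlt)
    exact absurd (Finset.le_max' _ _ this) (not_le.2 hn)

theorem log_term_nonneg (ha : IsCoeffFunction a) (hr : 0 < r) {n : ℕ}
    (hn : n ∈ (significantIndices_finite ha hr).toFinset) : 0 ≤ Real.log (a n * r ^ n) :=
  (Finite.mem_toFinset (significantIndices_finite ha hr)).1 hn

theorem bigS_eq (ha : IsCoeffFunction a) (hr : 0 < r) :
    bigS a r = 2 * ∑ n ∈ (significantIndices_finite ha hr).toFinset, Real.log (a n * r ^ n) := by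
  rw [bigS, finsum_mem_eq_finite_toFinset_sum]

theorem Icc_subset_significantIndices (ha : IsCoeffFunction a) (hr : 0 < r)
    (hN : IsLastSignificant a r N) :
    Finset.Icc 1 N ⊆ (significantIndices_finite ha hr).toFinset := fun n hn =>
  (Finite.mem_toFinset _).2 (hN.nonneg n hn)

theorem sum_Icc_le_bigS (ha : IsCoeffFunction a) (hr : 0 < r) (hN : IsLastSignificant a r N) :
    2 * ∑ n ∈ Finset.Icc 1 N, Real.log (a n * r ^ n) ≤ bigS a r := by
  rw [ha.bigS_eq hr]
  refine mul_le_mul_of_nonneg_left ?_ zero_le_two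
  exact Finset.sum_le_sum_of_subset_of_nonneg (ha.Icc_subset_significantIndices hr hN)
    fun n hn _ => ha.log_term_nonneg hr hn

theorem bigS_le_sum_Icc (ha : IsCoeffFunction a) (hr : 0 < r) (hN : IsLastSignificant a r N) :
    bigS a r ≤ 2 * ∑ n ∈ Finset.Icc 1 N, Real.log (a n * r ^ n) +
      2 * max (Real.log (a 0)) 0 := by
  rw [ha.bigS_eq hr, ← mul_add]
  refine mul_le_mul_of_nonneg_left ?_ zero_le_two
  have hsub : (significantIndices_finite ha hr).toFinset ⊆ insert 0 (Finset.Icc 1 N) := by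
    intro n hn
    have hn' : 0 ≤ Real.log (a n * r ^ n) := ha.log_term_nonneg hr hn
    have : n ≤ N := by
      by_contra hlt
      exact absurd (hN.neg n (not_le.1 hlt)) (not_lt.2 hn')
    rw [Finset.mem_insert, Finset.mem_Icc]
    omega
  calc ∑ n ∈ (significantIndices_finite ha hr).toFinset, Real.log (a n * r ^ n)
      ≤ ∑ n ∈ (significantIndices_finite ha hr).toFinset, max (Real.log (a n * r ^ n)) 0 :=
        Finset.sum_le_sum fun n _ => le_max_left _ _
    _ ≤ ∑ n ∈ insert 0 (Finset.Icc 1 N), max (Real.log (a n * r ^ n)) 0 :=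
        Finset.sum_le_sum_of_subset_of_nonneg hsub fun n _ _ => le_max_right _ _
    _ = ∑ n ∈ Finset.Icc 1 N, Real.log (a n * r ^ n) + max (Real.log (a 0)) 0 := by
        rw [Finset.sum_insert (by simp), add_comm]
        congr 1
        · exact Finset.sum_congr rfl fun n hn => max_eq_left (hN.nonneg n hn)
        · simp

theorem sq_div_two_le_sum_Icc (N : ℕ) : (N : ℝ) ^ 2 / 2 ≤ ∑ n ∈ Finset.Icc 1 N, (n : ℝ) := by
  induction N with
  | zero => simp
  | succ N ih =>
    rw [Finset.sum_Icc_succ_top (by omega)]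
    push_cast
    nlinarith

/-- Significant indices stay significant as the radius grows, and the `n`-th term gains `n (log s -
log r)`; twice the sum of `n` over `1, …, N` is at least `N ^ 2`. -/
theorem bigS_add_le (ha : IsCoeffFunction a) (hr : 0 < r) (hrs : r ≤ s)
    (hN : IsLastSignificant a r N) :
    bigS a r + N ^ 2 * (Real.log s - Real.log r) ≤ bigS a s := by
  have hs : 0 < s := hr.trans_le hrs
  have hlog : 0 ≤ Real.log s - Real.log r := sub_nonneg.2 (Real.log_le_log hr hrs)
  have hterm : ∀ n : ℕ, Real.log (a n * s ^ n) =
      Real.log (a n * r ^ n) + n * (Real.log s - Real.log r) := fun n => by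
    rw [ha.log_term hs, ha.log_term hr]; ring
  set A := (significantIndices_finite ha hr).toFinset with hA
  have hsub : A ⊆ (significantIndices_finite ha hs).toFinset := by
    intro n hn
    have hn' : 0 ≤ Real.log (a n * r ^ n) := ha.log_term_nonneg hr hn
    refine (Finite.mem_toFinset _).2 ?_
    change 0 ≤ Real.log (a n * s ^ n)
    rw [hterm]
    positivity
  have h1 : ∑ n ∈ A, Real.log (a n * s ^ n) ≤
      ∑ n ∈ (significantIndices_finite ha hs).toFinset, Real.log (a n * s ^ n) :=
    Finset.sum_le_sum_of_subset_of_nonneg hsub fun n hn _ => ha.log_term_nonneg hs hn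
  have h2 : ∑ n ∈ Finset.Icc 1 N, (n : ℝ) ≤ ∑ n ∈ A, (n : ℝ) :=
    Finset.sum_le_sum_of_subset_of_nonneg (ha.Icc_subset_significantIndices hr hN)
      fun n _ _ => n.cast_nonneg
  simp_rw [hterm] at h1
  rw [Finset.sum_add_distrib, ← Finset.sum_mul] at h1
  rw [ha.bigS_eq hr, ha.bigS_eq hs]
  simp_rw [hterm]
  have h3 := mul_le_mul_of_nonneg_right ((sq_div_two_le_sum_Icc N).trans h2) hlog
  linarith

/-- Beyond the last significant index the terms decay geometrically. -/
theorem log_term_le_neg_mul (ha : IsCoeffFunction a) (hr : 0 < r) (hN : IsLastSignificant a r N)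
    {σ : ℝ} (hσ0 : 0 ≤ σ)
    (hσ : 2 * N ^ 2 * σ ≤ bigS a r - 2 * max (Real.log (a 0)) 0) (j : ℕ) :
    Real.log (a (N + 1 + j : ℕ) * r ^ (N + 1 + j)) ≤ -(σ * j) := by
  have hneg := hN.neg (N + 1) (Nat.lt_succ_self N)
  rcases Nat.eq_zero_or_pos j with rfl | hj
  · simpa using hneg.le
  have hNpos : (0 : ℝ) < N := by exact_mod_cast hN.one_le
  -- The terms over `1, …, N` sum to at least `N ^ 2 * σ`, so some term reaches the average `N * σ`.
  obtain ⟨m, hm, hmσ⟩ : ∃ m ∈ Finset.Icc 1 N, N * σ ≤ Real.log (a m * r ^ m) := by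
    refine Finset.exists_le_of_sum_le (Finset.nonempty_Icc.2 hN.one_le) ?_
    rw [Finset.sum_const, Nat.card_Icc, nsmul_eq_mul]
    have := ha.bigS_le_sum_Icc hr hN
    simp only [Nat.add_sub_cancel]
    nlinarith
  obtain ⟨hm1, hm2⟩ := Finset.mem_Icc.1 hm
  have hm2' : (m : ℝ) ≤ N := by exact_mod_cast hm2
  have hm1' : (1 : ℝ) ≤ m := by exact_mod_cast hm1
  have hj' : (0 : ℝ) < j := by exact_mod_cast hj
  rw [ha.log_term hr] at hmσ hneg ⊢
  push_cast at hneg ⊢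
  have hslope := (ha.concaveOn_log_add (Real.log r)).slope_anti_adjacent (x := m) (y := N + 1)
    (z := N + 1 + j) (by simp) (by simp only [mem_Ici]; positivity) (by linarith) (by linarith)
  have hden : (0 : ℝ) < N + 1 - m := by linarith
  -- From `m` to `N + 1` the height falls by at least `N * σ` over a distance at most `N`; concavity
  -- propagates this slope beyond `N + 1`.
  have h1 : (Real.log (a (N + 1)) + (N + 1) * Real.log r - (Real.log (a m) + m * Real.log r)) /
      (N + 1 - m) ≤ -σ := by
    rw [div_le_iff₀ hden]
    nlinarith
  have h2 := hslope.trans h1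
  rw [div_le_iff₀ (by linarith)] at h2
  nlinarith

end IsCoeffFunction

/-! ### The exceptional set of radii. -/

theorem lintegral_one_div_Icc_le {b : ℝ} (hb : 0 < b) (ℓ : ℝ) :
    ∫⁻ t in Icc b (b * Real.exp ℓ), ENNReal.ofReal (1 / t) ≤
      ENNReal.ofReal (Real.exp ℓ - 1) := by
  calc ∫⁻ t in Icc b (b * Real.exp ℓ), ENNReal.ofReal (1 / t)
      ≤ ∫⁻ _ in Icc b (b * Real.exp ℓ), ENNReal.ofReal (1 / b) :=
        setLIntegral_mono measurable_const fun t ht =>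
          ENNReal.ofReal_le_ofReal (one_div_le_one_div_of_le hb ht.1)
    _ = ENNReal.ofReal (Real.exp ℓ - 1) := by
        rw [setLIntegral_const, Real.volume_Icc, ← ENNReal.ofReal_mul (by positivity)]
        congr 1
        field_simp

/-- Outside a set of finite logarithmic measure, `S(r)` is large and the number of significant
indices is at most about `S(r) ^ (1 / 2)`. -/
theorem IsCoeffFunction.exists_finiteLogMeasure {a : ℝ → ℝ} (ha : IsCoeffFunction a) {δ : ℝ}
    (hδ : 0 < δ) (B : ℝ) :
    ∃ E : Set ℝ, FiniteLogMeasure E ∧ ∀ r : ℝ, 1 ≤ r → r ∉ E → B ≤ bigS a r ∧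
      ∃ N, IsLastSignificant a r N ∧ (N : ℝ) ^ 2 ≤ bigS a r ^ (1 + δ) := by
  set B' := max B 1 with hB'
  set x₀ := |Real.log (a 1)| + B' with hx₀
  have hB1 : 1 ≤ B' := le_max_right _ _
  have hx₀pos : 0 ≤ x₀ := by positivity
  have hlarge : ∀ r, Real.exp x₀ ≤ r → 0 < r ∧ ∃ N, IsLastSignificant a r N ∧ B' ≤ bigS a r := by
    intro r hr
    have hr0 : 0 < r := (Real.exp_pos _).trans_le hr
    have hlog : x₀ ≤ Real.log r := (Real.le_log_iff_exp_le hr0).2 hr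
    have hB1 : B' ≤ Real.log (a 1) + Real.log r := by linarith [neg_abs_le (Real.log (a 1))]
    obtain ⟨N, hN⟩ := ha.exists_isLastSignificant hr0 (by linarith)
    refine ⟨hr0, N, hN, ?_⟩
    have h1 : Real.log (a (1 : ℕ) * r ^ 1) ≤ ∑ n ∈ Finset.Icc 1 N, Real.log (a n * r ^ n) :=
      Finset.single_le_sum (f := fun n : ℕ => Real.log (a n * r ^ n)) hN.nonneg
        (Finset.mem_Icc.2 ⟨le_rfl, hN.one_le⟩)
    rw [ha.log_term hr0] at h1
    have h2 := ha.sum_Icc_le_bigS hr0 hN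
    push_cast at h1
    linarith
  set bad : ℕ → Set ℝ := fun k => {r | Real.exp x₀ ≤ r ∧ 2 ^ k ≤ bigS a r ∧
    bigS a r < 2 ^ (k + 1) ∧ ∃ N, IsLastSignificant a r N ∧ bigS a r ^ (1 + δ) < (N : ℝ) ^ 2}
    with hbad
  set q : ℝ := 2 ^ (-δ) with hq
  have hq0 : 0 < q := by positivity
  have hq1 : q < 1 := Real.rpow_lt_one_of_one_lt_of_neg one_lt_two (by linarith)
  -- Between two bad radii of level `k`, `S` increases by at most `2 ^ k`, but at logarithmic rate
  -- at least `2 ^ (k (1 + δ)) = 2 ^ k / q ^ k`.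
  have hgap : ∀ k, ∀ u ∈ bad k, ∀ v ∈ bad k, v * Real.exp (-q ^ k) ≤ u := by
    intro k u hu v hv
    obtain ⟨hu0, hu1, hu2, N, hN, hNu⟩ := hu
    obtain ⟨hv0, hv1, hv2, -⟩ := hv
    have hup := (hlarge u hu0).1
    have hvp := (hlarge v hv0).1
    rcases le_total v u with h | h
    · refine le_trans (mul_le_of_le_one_right hvp.le (Real.exp_le_one_iff.2 ?_)) h
      simp only [Left.neg_nonpos_iff]
      positivity
    · have hg := ha.bigS_add_le hup h hN
      have hp : (2 : ℝ) ^ k / q ^ k ≤ (N : ℝ) ^ 2 := by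
        refine le_trans ?_ hNu.le
        have : (2 : ℝ) ^ k / q ^ k = (2 ^ k : ℝ) ^ (1 + δ) := by
          rw [hq, ← Real.rpow_natCast (2 ^ (-δ)) k, ← Real.rpow_natCast 2 k,
            ← Real.rpow_mul zero_le_two, ← Real.rpow_mul zero_le_two, ← Real.rpow_sub two_pos]
          congr 1
          ring
        rw [this]
        exact Real.rpow_le_rpow (by positivity) hu1 (by linarith)
      have hlog0 : 0 ≤ Real.log v - Real.log u := sub_nonneg.2 (Real.log_le_log hup h)
      have h1 := mul_le_mul_of_nonneg_right hp hlog0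
      have h2 : (2 : ℝ) ^ k / q ^ k * (Real.log v - Real.log u) ≤ 2 ^ k := by
        rw [pow_succ] at hv2
        linarith
      rw [div_mul_eq_mul_div, div_le_iff₀ (by positivity)] at h2
      have h3 : Real.log v - Real.log u ≤ q ^ k := le_of_mul_le_mul_left h2 (by positivity)
      rw [← Real.exp_log hvp, ← Real.exp_log hup, ← Real.exp_add]
      exact Real.exp_le_exp.2 (by linarith)
  -- Replacing `bad k` by an interval gives measurability for free. The maximum with `1` covers an
  -- empty `bad k`, where `sInf` is `0`.
  set b : ℕ → ℝ := fun k => max 1 (sInf (bad k)) with hb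
  have hb1 : ∀ k, 1 ≤ b k := fun k => le_max_left _ _
  set J : ℕ → Set ℝ := fun k => Icc (b k) (b k * Real.exp (q ^ k)) with hJ
  have hbadJ : ∀ k, bad k ⊆ J k := by
    intro k v hv
    have hbdd : BddBelow (bad k) := ⟨Real.exp x₀, fun u hu => hu.1⟩
    have hv1 : 1 ≤ v := (Real.one_le_exp hx₀pos).trans hv.1
    refine ⟨max_le hv1 (csInf_le hbdd hv), ?_⟩
    have h1 : v * Real.exp (-q ^ k) ≤ sInf (bad k) :=
      le_csInf ⟨v, hv⟩ fun u hu => hgap k u hu v hv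
    rw [Real.exp_neg, ← div_eq_mul_inv, div_le_iff₀ (Real.exp_pos _)] at h1
    refine h1.trans ?_
    gcongr
    exact le_max_right _ _
  refine ⟨Icc 1 (1 * Real.exp x₀) ∪ ⋃ k, J k, ⟨?_, ?_, ?_⟩, ?_⟩
  · exact measurableSet_Icc.union (MeasurableSet.iUnion fun k => measurableSet_Icc)
  · refine union_subset Icc_subset_Ici_self (iUnion_subset fun k t ht => ?_)
    exact (hb1 k).trans ht.1
  · refine (lintegral_union_le _ _ _).trans_lt (ENNReal.add_lt_top.2 ⟨?_, ?_⟩)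
    · exact (lintegral_one_div_Icc_le one_pos x₀).trans_lt ENNReal.ofReal_lt_top
    · refine (lintegral_iUnion_le _ _).trans_lt ?_
      have hle : ∀ k, ∫⁻ t in J k, ENNReal.ofReal (1 / t) ≤ ENNReal.ofReal (2 * q ^ k) := by
        intro k
        have hqk : q ^ k ≤ 1 := pow_le_one₀ hq0.le hq1.le
        have hqk0 : 0 ≤ q ^ k := by positivity
        refine (lintegral_one_div_Icc_le (one_pos.trans_le (hb1 k)) _).trans
          (ENNReal.ofReal_le_ofReal ?_)
        have := Real.abs_exp_sub_one_le (x := q ^ k) (by rwa [abs_of_nonneg hqk0])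
        rw [abs_of_nonneg hqk0] at this
        exact (le_abs_self _).trans this
      refine (ENNReal.tsum_le_tsum hle).trans_lt ?_
      have hsum : Summable fun k => 2 * q ^ k :=
        (summable_geometric_of_lt_one hq0.le hq1).mul_left 2
      rw [← ENNReal.ofReal_tsum_of_nonneg (fun k => by positivity) hsum]
      exact ENNReal.ofReal_lt_top
  · intro r hr hrE
    simp only [one_mul, mem_union, mem_iUnion, not_or, not_exists, mem_Icc, not_and, not_le] at hrE
    obtain ⟨hrE1, hrE2⟩ := hrE
    obtain ⟨hr0, N, hN, hS⟩ := hlarge r (hrE1 hr).le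
    refine ⟨(le_max_left _ _).trans hS, N, hN, ?_⟩
    by_contra hlt
    obtain ⟨k, hk1, hk2⟩ := exists_nat_pow_near (hB1.trans hS) one_lt_two
    exact hrE2 k (hbadJ k ⟨(hrE1 hr).le, hk1, hk2, N, hN, not_le.1 hlt⟩)

/-! ### Auxiliary sums. -/

theorem sum_Icc_one_eq_sum_range (f : ℕ → ℝ) (N : ℕ) :
    ∑ n ∈ Finset.Icc 1 N, f n = ∑ n ∈ Finset.range N, f (n + 1) := by
  induction N with
  | zero => simp
  | succ N ih => rw [Finset.sum_Icc_succ_top (by omega), ih, Finset.sum_range_succ]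

theorem hasSum_exp_neg_mul {u : ℝ} (hu : 0 < u) :
    HasSum (fun j : ℕ => Real.exp (-(u * j))) (1 - Real.exp (-u))⁻¹ := by
  have h := hasSum_geometric_of_lt_one (Real.exp_pos (-u)).le
    (Real.exp_zero ▸ Real.exp_lt_exp.2 (neg_lt_zero.2 hu))
  refine h.congr_fun fun j => ?_
  rw [← Real.exp_nat_mul]
  congr 1
  ring

theorem inv_one_sub_exp_neg_le {u : ℝ} (hu : 0 < u) (hu1 : u ≤ 1) :
    (1 - Real.exp (-u))⁻¹ ≤ 2 / u := by
  have h1 : Real.exp (-u) ≤ 1 - u / 2 := by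
    have h2 : Real.exp (-u) ≤ (1 + u)⁻¹ := by
      rw [Real.exp_neg]
      exact inv_anti₀ (by positivity) (by linarith [Real.add_one_le_exp u])
    refine h2.trans ?_
    rw [inv_le_iff_one_le_mul₀ (by positivity)]
    nlinarith
  rw [show 2 / u = (u / 2)⁻¹ by field_simp]
  exact inv_anti₀ (by positivity) (by linarith)

/-! ### Lower bound for the hole probability: a dominant constant term. -/

section HoleProbLowerBound

variable {Ω : Type*} {φ : ℕ → Ω → ℂ} {a : ℝ → ℝ} {r : ℝ} {N : ℕ} {σ : ℝ}

/-- The constant term exceeds `2`, while the middle terms total at most `1` and the tail at most `1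
/ 2`. -/
theorem gaussianEntire_ne_zero (ha : IsCoeffFunction a) (hr : 0 < r) (hN : IsLastSignificant a r N)
    (hσ0 : 0 < σ) (hσ1 : σ ≤ 1)
    (htail : ∀ j : ℕ, Real.log (a (N + 1 + j : ℕ) * r ^ (N + 1 + j)) ≤ -(σ * j)) {ω : Ω}
    (h0 : 2 / a 0 < ‖φ 0 ω‖)
    (h1 : ∀ n < N, ‖φ (n + 1) ω‖ ≤
      Real.exp (-Real.log (a (n + 1 : ℕ) * r ^ (n + 1))) / N)
    (h2 : ∀ j : ℕ, ‖φ (N + 1 + j) ω‖ ≤ σ / 8 * Real.exp (σ / 2 * j)) {z : ℂ} (hz : ‖z‖ ≤ r) :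
    gaussianEntire a φ ω z ≠ 0 := by
  set f : ℕ → ℂ := fun n => φ n ω * (a n : ℂ) * z ^ n with hf
  have hpos : ∀ n : ℕ, 0 < a n * r ^ n := fun n => mul_pos (ha.pos n n.cast_nonneg) (pow_pos hr n)
  have hfn : ∀ n, ‖f n‖ ≤ ‖φ n ω‖ * (a n * r ^ n) := by
    intro n
    rw [hf, norm_mul, norm_mul, norm_pow, Complex.norm_real, Real.norm_eq_abs,
      abs_of_pos (ha.pos n n.cast_nonneg), mul_assoc]
    have := (ha.pos n n.cast_nonneg).le
    gcongr
  have htl : ∀ j, ‖f (j + (N + 1))‖ ≤ σ / 8 * Real.exp (-(σ / 2 * j)) := by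
    intro j
    rw [add_comm j]
    refine (hfn _).trans ?_
    rw [← Real.exp_log (hpos (N + 1 + j))]
    calc ‖φ (N + 1 + j) ω‖ * Real.exp (Real.log (a (N + 1 + j : ℕ) * r ^ (N + 1 + j)))
        ≤ σ / 8 * Real.exp (σ / 2 * j) * Real.exp (-(σ * j)) := by
          gcongr
          · exact h2 j
          · exact htail j
      _ = σ / 8 * Real.exp (-(σ / 2 * j)) := by
          rw [mul_assoc, ← Real.exp_add]
          congr 2
          ring
  have hgeo := (hasSum_exp_neg_mul (half_pos hσ0)).mul_left (σ / 8)
  have hsum : Summable f := (summable_nat_add_iff (N + 1)).1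
    (Summable.of_norm_bounded hgeo.summable htl)
  have hT : ‖∑' j, f (j + (N + 1))‖ ≤ 1 / 2 := by
    refine (tsum_of_norm_bounded hgeo htl).trans ?_
    calc σ / 8 * (1 - Real.exp (-(σ / 2)))⁻¹ ≤ σ / 8 * (2 / (σ / 2)) := by
          gcongr
          exact inv_one_sub_exp_neg_le (half_pos hσ0) (by linarith)
      _ = 1 / 2 := by field_simp; norm_num
  have hM : ‖∑ n ∈ Finset.range N, f (n + 1)‖ ≤ 1 := by
    have hN0 : (N : ℝ) ≠ 0 := by
      have := hN.one_le
      positivity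
    calc ‖∑ n ∈ Finset.range N, f (n + 1)‖ ≤ ∑ n ∈ Finset.range N, (1 / N : ℝ) := by
          refine norm_sum_le_of_le _ fun n hn => (hfn _).trans ?_
          refine (mul_le_mul_of_nonneg_right (h1 n (Finset.mem_range.1 hn)) (hpos _).le).trans ?_
          rw [Real.exp_neg, Real.exp_log (hpos _), div_mul_eq_mul_div,
            inv_mul_cancel₀ (hpos _).ne']
      _ = 1 := by
          rw [Finset.sum_const, Finset.card_range, nsmul_eq_mul]
          field_simp
  have hf0 : 2 < ‖f 0‖ := by
    have ha0 := ha.pos 0 le_rfl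
    rw [div_lt_iff₀ ha0] at h0
    simpa [hf, abs_of_pos ha0] using h0
  have hdecomp : gaussianEntire a φ ω z =
      f 0 + ∑ n ∈ Finset.range N, f (n + 1) + ∑' j, f (j + (N + 1)) := by
    rw [gaussianEntire, ← hsum.sum_add_tsum_nat_add (N + 1), Finset.sum_range_succ', add_comm (f 0)]
  intro hzero
  rw [hdecomp] at hzero
  have : f 0 = -(∑ n ∈ Finset.range N, f (n + 1)) - ∑' j, f (j + (N + 1)) := by
    linear_combination hzero
  have h3 := norm_sub_le (-(∑ n ∈ Finset.range N, f (n + 1))) (∑' j, f (j + (N + 1)))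
  rw [← this, norm_neg] at h3
  linarith

variable [MeasurableSpace Ω] {P : Measure Ω} [IsProbabilityMeasure P]

theorem IsIIDComplexGaussian.exp_neg_le_holeProb (hφ : IsIIDComplexGaussian P φ)
    (ha : IsCoeffFunction a) (hr : 0 < r) (hN : IsLastSignificant a r N)
    (hσ0 : 0 < σ) (hσ1 : σ ≤ 1)
    (htail : ∀ j : ℕ, Real.log (a (N + 1 + j : ℕ) * r ^ (N + 1 + j)) ≤ -(σ * j)) :
    Real.exp (-((2 / a 0) ^ 2 + (bigS a r + N * (1 + 2 * Real.log N)) + 128 / σ ^ 3)) ≤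
      holeProb P a φ r := by
  have ha0 := ha.pos 0 le_rfl
  have hN1 : (1 : ℝ) ≤ N := by exact_mod_cast hN.one_le
  set h : ℕ → ℝ := fun n => Real.log (a n * r ^ n) with hh
  -- Past `N` the radii grow at half the decay rate of `a n * r ^ n`: the tail of the series still
  -- converges geometrically, and so do the costs `τ n ^ (-2)`.
  set τ : ℕ → ℝ := fun n => if n ≤ N then Real.exp (-h n) / N
    else σ / 8 * Real.exp (σ / 2 * ((n : ℝ) - (N + 1))) with hτ
  have hτpos : ∀ n, 0 < τ n := by
    intro n
    simp only [hτ]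
    split_ifs <;> positivity
  set G : ℕ → Set ℂ := fun n => if n = 0 then {z | 2 / a 0 < ‖z‖} else Metric.closedBall 0 (τ n)
    with hG
  set b : ℕ → ℝ := fun n => if n = 0 then (2 / a 0) ^ 2 else Real.log (1 + (τ n ^ 2)⁻¹) with hb
  have hGm : ∀ n, MeasurableSet (G n) := by
    intro n
    simp only [hG]
    split_ifs
    · exact measurableSet_lt measurable_const measurable_norm
    · exact Metric.isClosed_closedBall.measurableSet
  have hbG : ∀ n, ENNReal.ofReal (Real.exp (-b n)) ≤ stdComplexGaussian (G n) := by
    intro n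
    simp only [hG, hb]
    split_ifs
    · exact (stdComplexGaussian_norm_gt (by positivity)).ge
    · exact le_stdComplexGaussian_closedBall (hτpos n)
  have hb0 : ∀ n, 0 ≤ b n := by
    intro n
    simp only [hb]
    split_ifs
    · positivity
    · refine Real.log_nonneg ?_
      have := hτpos n
      have : 0 < (τ n ^ 2)⁻¹ := by positivity
      linarith
  have hmid : ∀ n ∈ Finset.range N, b (n + 1) ≤ 2 * h (n + 1) + (1 + 2 * Real.log N) := by
    intro n hn
    have hle : n + 1 ≤ N := Finset.mem_range.1 hn
    have hhn : 0 ≤ h (n + 1) := hN.nonneg _ (Finset.mem_Icc.2 ⟨by omega, hle⟩)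
    have h1 : (τ (n + 1) ^ 2)⁻¹ = N ^ 2 * Real.exp (2 * h (n + 1)) := by
      -- The factor `N ^ 2` comes from sharing the budget `1` among `N` terms; it is the source of
      -- the `N log N` loss.
      simp only [hτ, hle, if_true]
      rw [two_mul, Real.exp_add, Real.exp_neg]
      field_simp
    have h2 : 1 ≤ (N : ℝ) ^ 2 * Real.exp (2 * h (n + 1)) :=
      one_le_mul_of_one_le_of_one_le (one_le_pow₀ hN1) (Real.one_le_exp (by positivity))
    simp only [hb, Nat.succ_ne_zero, if_false]
    rw [h1]
    calc Real.log (1 + N ^ 2 * Real.exp (2 * h (n + 1)))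
        ≤ Real.log (2 * (N ^ 2 * Real.exp (2 * h (n + 1)))) :=
          Real.log_le_log (by positivity) (by linarith)
      _ = Real.log 2 + (2 * Real.log N + 2 * h (n + 1)) := by
          rw [Real.log_mul (by norm_num) (by positivity), Real.log_mul (by positivity)
            (by positivity), Real.log_exp, Real.log_pow]
          norm_num
      _ ≤ _ := by linarith [Real.log_two_lt_d9]
  have htl : ∀ j, b (N + 1 + j) ≤ 64 / σ ^ 2 * Real.exp (-(σ * j)) := by
    intro j
    have hnot : ¬ N + 1 + j ≤ N := by omega
    have h1 : (τ (N + 1 + j) ^ 2)⁻¹ = 64 / σ ^ 2 * Real.exp (-(σ * j)) := by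
      simp only [hτ, hnot, if_false]
      push_cast
      rw [add_sub_cancel_left, mul_pow, ← Real.exp_nat_mul, mul_inv, ← Real.exp_neg]
      congr 1
      · field_simp; norm_num
      · congr 1; push_cast; ring
    have hne : N + 1 + j ≠ 0 := by omega
    simp only [hb, hne, if_false]
    rw [← h1]
    have hp : 0 < (τ (N + 1 + j) ^ 2)⁻¹ := by
      have := hτpos (N + 1 + j)
      positivity
    linarith [Real.log_le_sub_one_of_pos (show 0 < 1 + (τ (N + 1 + j) ^ 2)⁻¹ by linarith)]
  have hgeo := (hasSum_exp_neg_mul hσ0).mul_left (64 / σ ^ 2)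
  have hB : ∀ m, ∑ n ∈ Finset.range m, b n ≤
      (2 / a 0) ^ 2 + (bigS a r + N * (1 + 2 * Real.log N)) + 128 / σ ^ 3 := by
    intro m
    calc ∑ n ∈ Finset.range m, b n ≤ ∑ n ∈ Finset.range (N + 1 + m), b n :=
          Finset.sum_le_sum_of_subset_of_nonneg
            (Finset.range_subset_range.2 (by omega)) fun n _ _ => hb0 n
      _ = b 0 + ∑ n ∈ Finset.range N, b (n + 1) + ∑ j ∈ Finset.range m, b (N + 1 + j) := by
          rw [Finset.sum_range_add, Finset.sum_range_succ', add_comm (b 0)]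
      _ ≤ (2 / a 0) ^ 2 + (bigS a r + N * (1 + 2 * Real.log N)) + 128 / σ ^ 3 := by
          refine add_le_add (add_le_add (by simp [hb]) ?_) ?_
          · refine (Finset.sum_le_sum hmid).trans ?_
            rw [Finset.sum_add_distrib, Finset.sum_const, Finset.card_range, nsmul_eq_mul,
              ← Finset.mul_sum, ← sum_Icc_one_eq_sum_range h N]
            linarith [ha.sum_Icc_le_bigS hr hN]
          · refine (Finset.sum_le_sum fun j _ => htl j).trans ?_
            refine (sum_le_hasSum _ (fun j _ => by positivity) hgeo).trans ?_
            calc 64 / σ ^ 2 * (1 - Real.exp (-σ))⁻¹ ≤ 64 / σ ^ 2 * (2 / σ) := by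
                  gcongr
                  exact inv_one_sub_exp_neg_le hσ0 hσ1
              _ = 128 / σ ^ 3 := by field_simp; norm_num
  have hprob := hφ.exp_neg_le_measure_forall hGm hbG hB
  have hsub : {ω | ∀ n, φ n ω ∈ G n} ⊆ {ω | ∀ z : ℂ, ‖z‖ ≤ r → gaussianEntire a φ ω z ≠ 0} := by
    intro ω hω z hz
    rw [mem_ofPred_eq] at hω
    refine gaussianEntire_ne_zero ha hr hN hσ0 hσ1 htail ?_ (fun n hn => ?_) (fun j => ?_) hz
    · simpa [hG] using hω 0
    · have hle : n + 1 ≤ N := hn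
      have := hω (n + 1)
      simpa [hG, hτ, hle, hh] using this
    · have := hω (N + 1 + j)
      have hnot : ¬ N + 1 + j ≤ N := by omega
      have hne : N + 1 + j ≠ 0 := by omega
      simp only [hG, hτ, hnot, hne, if_false, mem_closedBall_zero_iff] at this
      push_cast at this
      rwa [add_sub_cancel_left] at this
  rw [holeProb, Measure.real, ← ENNReal.ofReal_le_iff_le_toReal (measure_ne_top _ _)]
  exact hprob.trans (measure_mono hsub)

end HoleProbLowerBound

/-! ### Upper bound for the hole probability: confinement of the coefficients. -/

section HoleProbUpperBound

variable {Ω : Type*} {φ : ℕ → Ω → ℂ} {a : ℝ → ℝ} {r : ℝ} {N : ℕ} {σ T : ℝ}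

/-- Here `y log y ≥ y - 1`. Applied to `y = ‖c 0‖`, this removes any need for a lower bound on the
constant term: the prefactor `‖c 0‖` absorbs `-log ‖c 0‖`. -/
theorem mul_sub_log_le {y K L : ℝ} (hy : 0 < y) (hyK : y ≤ K) (hL : 0 ≤ L) :
    y * (L - Real.log y) ≤ K * L + 1 := by
  have h1 := Real.one_sub_inv_le_log_of_pos hy
  have h2 : y * (1 - y⁻¹) ≤ y * Real.log y := mul_le_mul_of_nonneg_left h1 hy.le
  rw [mul_sub, mul_inv_cancel₀ hy.ne'] at h2
  nlinarith

/-- The growth of `f` when `‖φ n‖ ≤ 2 * T + n` for all `n`. -/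
theorem summable_and_tsum_le (ha : IsCoeffFunction a) (hr : 0 < r) (hN : IsLastSignificant a r N)
    (hσ0 : 0 < σ) (hσ1 : σ ≤ 1)
    (htail : ∀ j : ℕ, Real.log (a (N + 1 + j : ℕ) * r ^ (N + 1 + j)) ≤ -(σ * j))
    (hT : 0 ≤ T) (hST : bigS a r ≤ T) (h0T : Real.log (a 0) ≤ T) :
    Summable (fun n : ℕ => (2 * T + n) * (a n * r ^ n)) ∧
      ∑' n : ℕ, (2 * T + n) * (a n * r ^ n) ≤
        (N + 1) * ((2 * T + N) * Real.exp T) + (2 * T + (N + 1)) * (8 / σ ^ 2) := by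
  set f : ℕ → ℝ := fun n => (2 * T + n) * (a n * r ^ n) with hf
  have hpos : ∀ n : ℕ, 0 < a n * r ^ n := fun n => mul_pos (ha.pos n n.cast_nonneg) (pow_pos hr n)
  have hf0 : ∀ n, 0 ≤ f n := fun n => mul_nonneg (by positivity) (hpos n).le
  have hhead : ∀ n ∈ Finset.range (N + 1), f n ≤ (2 * T + N) * Real.exp T := by
    intro n hn
    have hnN : n ≤ N := Nat.lt_succ_iff.1 (Finset.mem_range.1 hn)
    have hlog : Real.log (a n * r ^ n) ≤ T := by
      rcases Nat.eq_zero_or_pos n with rfl | hn0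
      · simpa using h0T
      · have h1 : Real.log (a n * r ^ n) ≤ ∑ n ∈ Finset.Icc 1 N, Real.log (a n * r ^ n) :=
          Finset.single_le_sum (f := fun n : ℕ => Real.log (a n * r ^ n)) hN.nonneg
            (Finset.mem_Icc.2 ⟨hn0, hnN⟩)
        linarith [ha.sum_Icc_le_bigS hr hN]
    have hn' : (n : ℝ) ≤ N := by exact_mod_cast hnN
    simp only [hf]
    have := (hpos n).le
    have := (Real.log_le_iff_le_exp (hpos n)).1 hlog
    gcongr
  have hgeo := (hasSum_exp_neg_mul (half_pos hσ0)).mul_left ((2 * T + (N + 1)) * (2 / σ))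
  have htl : ∀ j : ℕ, f (j + (N + 1)) ≤
      (2 * T + (N + 1)) * (2 / σ) * Real.exp (-(σ / 2 * j)) := by
    intro j
    have h1 : a (j + (N + 1) : ℕ) * r ^ (j + (N + 1)) ≤ Real.exp (-(σ * j)) := by
      rw [add_comm j]
      exact (Real.log_le_iff_le_exp (hpos _)).1 (htail j)
    -- Half of the decay rate is spent on absorbing the linear growth.
    have h2 : 1 + (j : ℝ) ≤ 2 / σ * Real.exp (σ / 2 * j) := by
      have h3 := Real.add_one_le_exp (σ / 2 * j)
      have h4 : 2 / σ * (σ / 2 * j + 1) = j + 2 / σ := by field_simp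
      have h5 : 1 ≤ 2 / σ := by rw [le_div_iff₀ hσ0]; linarith
      have h6 := mul_le_mul_of_nonneg_left h3 (show 0 ≤ 2 / σ by positivity)
      linarith
    have h3 : 2 * T + ((j + (N + 1) : ℕ) : ℝ) ≤ (2 * T + (N + 1)) * (1 + j) := by
      push_cast
      nlinarith [mul_nonneg hT (Nat.cast_nonneg (α := ℝ) j),
        mul_nonneg (Nat.cast_nonneg (α := ℝ) N) (Nat.cast_nonneg (α := ℝ) j)]
    calc f (j + (N + 1)) ≤ ((2 * T + (N + 1)) * (1 + j)) * Real.exp (-(σ * j)) := by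
          rw [hf]
          exact mul_le_mul h3 h1 (hpos _).le (by positivity)
      _ ≤ ((2 * T + (N + 1)) * (2 / σ * Real.exp (σ / 2 * j))) * Real.exp (-(σ * j)) := by
          gcongr
      _ = (2 * T + (N + 1)) * (2 / σ) * Real.exp (-(σ / 2 * j)) := by
          rw [← mul_assoc, mul_assoc _ (Real.exp _), ← Real.exp_add]
          congr 2
          ring
  have hsumt : Summable fun j => f (j + (N + 1)) :=
    Summable.of_nonneg_of_le (fun j => hf0 _) htl hgeo.summable
  have hsum : Summable f := (summable_nat_add_iff (N + 1)).1 hsumt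
  refine ⟨hsum, ?_⟩
  rw [← hsum.sum_add_tsum_nat_add (N + 1)]
  refine add_le_add ?_ ?_
  · refine (Finset.sum_le_sum hhead).trans (le_of_eq ?_)
    rw [Finset.sum_const, Finset.card_range, nsmul_eq_mul]
    push_cast
    ring
  · refine (hsumt.tsum_le_tsum htl hgeo.summable).trans ?_
    rw [hgeo.tsum_eq]
    calc (2 * T + (N + 1)) * (2 / σ) * (1 - Real.exp (-(σ / 2)))⁻¹
        ≤ (2 * T + (N + 1)) * (2 / σ) * (2 / (σ / 2)) := by
          gcongr
          exact inv_one_sub_exp_neg_le (half_pos hσ0) (by linarith)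
      _ = (2 * T + (N + 1)) * (8 / σ ^ 2) := by field_simp; norm_num

/-- On the hole event each coefficient is confined to a small disc determined by the previous
ones. -/
theorem norm_sub_taylorCentre_div_le (ha : IsCoeffFunction a) (hr : 0 < r)
    (hsum : Summable (fun n : ℕ => (2 * T + n) * (a n * r ^ n)))
    (htsum : ∑' n : ℕ, (2 * T + n) * (a n * r ^ n) ≤ Real.exp (2 * T)) (hT : 0 ≤ T)
    (ha0 : 2 * T * a 0 < Real.exp (2 * T)) {ω : Ω} (hω : ∀ n, ‖φ n ω‖ ≤ 2 * T + n)
    (hhole : ∀ z : ℂ, ‖z‖ ≤ r → gaussianEntire a φ ω z ≠ 0) {n : ℕ} (hn : n < N) :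
    ‖φ (n + 1) ω - taylorCentre n (fun i => φ i ω * (a i * r ^ i : ℝ)) /
      (a (n + 1 : ℕ) * r ^ (n + 1) : ℝ)‖ ≤
      12 * (4 * T ^ 2 * a 0 + 1) * N / (a (n + 1 : ℕ) * r ^ (n + 1)) := by
  have hpos : ∀ n : ℕ, 0 < a n * r ^ n := fun n => mul_pos (ha.pos n n.cast_nonneg) (pow_pos hr n)
  set c : ℕ → ℂ := fun i => φ i ω * (a i * r ^ i : ℝ) with hc
  have hcn : ∀ n, ‖c n‖ ≤ (2 * T + n) * (a n * r ^ n) := by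
    intro n
    rw [hc, norm_mul, Complex.norm_real, Real.norm_eq_abs, abs_of_pos (hpos n)]
    exact mul_le_mul_of_nonneg_right (hω n) (hpos n).le
  have hterm : ∀ z ∈ Metric.ball (0 : ℂ) 1, ∀ n, ‖c n * z ^ n‖ ≤ (2 * T + n) * (a n * r ^ n) := by
    intro z hz n
    rw [norm_mul, norm_pow]
    refine (mul_le_of_le_one_right (norm_nonneg _) (pow_le_one₀ (norm_nonneg _) ?_)).trans (hcn n)
    exact (mem_ball_zero_iff.1 hz).le
  -- Rescaling to the unit disc gives coefficients `φ n * a n * r ^ n`, so dividing by `a n * r ^ n`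
  -- later returns a disc for `φ n` itself.
  set F : ℂ → ℂ := fun z => gaussianEntire a φ ω (r * z) with hF
  have hFeq : ∀ z, F z = ∑' n, c n * z ^ n := by
    intro z
    simp only [hF, gaussianEntire, hc]
    congr 1 with n
    push_cast
    ring
  have hFsum : ∀ z ∈ Metric.ball (0 : ℂ) 1, HasSum (fun n => c n * z ^ n) (F z) := by
    intro z hz
    rw [hFeq]
    exact (Summable.of_norm_bounded hsum (hterm z hz)).hasSum
  have hF0 : ∀ z ∈ Metric.ball (0 : ℂ) 1, F z ≠ 0 := by
    intro z hz
    refine hhole _ ?_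
    rw [norm_mul, Complex.norm_real, Real.norm_eq_abs, abs_of_pos hr]
    exact mul_le_of_le_one_right hr.le (mem_ball_zero_iff.1 hz).le
  have hFL : ∀ z ∈ Metric.ball (0 : ℂ) 1, ‖F z‖ ≤ Real.exp (2 * T) := by
    intro z hz
    rw [hFeq]
    exact (tsum_of_norm_bounded hsum.hasSum (hterm z hz)).trans htsum
  have hc0 : ‖c 0‖ ≤ 2 * T * a 0 := by simpa using hcn 0
  have hc0pos : 0 < ‖c 0‖ := by
    refine norm_pos_iff.2 fun h => hF0 0 (by simp) ?_
    rw [hFeq, tsum_eq_single 0 fun n hn => by simp [hn]]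
    simp [h]
  have hlog : Real.log ‖c 0‖ < 2 * T := (Real.log_lt_iff_lt_exp hc0pos).2 (hc0.trans_lt ha0)
  have hkey := norm_sub_taylorCentre_le hFsum hF0 hFL hlog n
  have hbound : ‖c (n + 1) - taylorCentre n c‖ ≤ 12 * (4 * T ^ 2 * a 0 + 1) * N := by
    refine hkey.trans ?_
    have h1 := mul_sub_log_le hc0pos hc0 (show 0 ≤ 2 * T by positivity)
    have h2 : ((n : ℝ) + 1) ≤ N := by exact_mod_cast hn
    have ha0' := ha.pos 0 le_rfl
    calc ‖c 0‖ * (12 * (2 * T - Real.log ‖c 0‖) * (n + 1))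
        = 12 * (‖c 0‖ * (2 * T - Real.log ‖c 0‖)) * (n + 1) := by ring
      _ ≤ 12 * (2 * T * a 0 * (2 * T) + 1) * N := by gcongr
      _ = 12 * (4 * T ^ 2 * a 0 + 1) * N := by ring
  have hp := hpos (n + 1)
  have hpC : ((a (n + 1 : ℕ) * r ^ (n + 1) : ℝ) : ℂ) ≠ 0 := by exact_mod_cast hp.ne'
  have heq : φ (n + 1) ω - taylorCentre n c / (a (n + 1 : ℕ) * r ^ (n + 1) : ℝ) =
      (c (n + 1) - taylorCentre n c) / (a (n + 1 : ℕ) * r ^ (n + 1) : ℝ) := by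
    rw [sub_div, hc, mul_div_cancel_right₀ _ hpC]
  rw [heq, norm_div, Complex.norm_real, Real.norm_eq_abs, abs_of_pos hp]
  gcongr

variable [MeasurableSpace Ω] {P : Measure Ω}

theorem IsIIDComplexGaussian.measure_exists_norm_gt_le (hφ : IsIIDComplexGaussian P φ)
    (hT : 1 ≤ T) :
    P {ω | ∃ n : ℕ, 2 * T + n < ‖φ n ω‖} ≤ ENNReal.ofReal (Real.exp (-T)) := by
  have hset : {ω | ∃ n : ℕ, 2 * T + n < ‖φ n ω‖} = ⋃ n : ℕ, φ n ⁻¹' {z | 2 * T + n < ‖z‖} := by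
    ext ω; simp
  have hmeas : ∀ t : ℝ, MeasurableSet {z : ℂ | t < ‖z‖} := fun t =>
    measurableSet_lt measurable_const measurable_norm
  have hgeo := (hasSum_exp_neg_mul one_pos).mul_left (Real.exp (-(2 * T)))
  rw [hset]
  refine (measure_iUnion_le _).trans ?_
  calc ∑' n : ℕ, P (φ n ⁻¹' {z | 2 * T + n < ‖z‖})
      ≤ ∑' n : ℕ, ENNReal.ofReal (Real.exp (-(2 * T)) * Real.exp (-(1 * n))) := by
        refine ENNReal.tsum_le_tsum fun n => ?_
        rw [← Measure.map_apply (hφ.measurable n) (hmeas _), hφ.law n,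
          stdComplexGaussian_norm_gt (by positivity), ← Real.exp_add]
        refine ENNReal.ofReal_le_ofReal (Real.exp_le_exp.2 ?_)
        have : (0 : ℝ) ≤ n := n.cast_nonneg
        nlinarith
    _ = ENNReal.ofReal (Real.exp (-(2 * T)) * (1 - Real.exp (-1))⁻¹) := by
        rw [← ENNReal.ofReal_tsum_of_nonneg (fun n => by positivity) hgeo.summable, hgeo.tsum_eq]
    _ ≤ ENNReal.ofReal (Real.exp (-T)) := by
        refine ENNReal.ofReal_le_ofReal ?_
        have h1 := inv_one_sub_exp_neg_le one_pos le_rfl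
        have h2 : 2 ≤ Real.exp T := by linarith [Real.add_one_le_exp T]
        calc Real.exp (-(2 * T)) * (1 - Real.exp (-1))⁻¹
            ≤ Real.exp (-(2 * T)) * Real.exp T := by
              gcongr
              linarith
          _ = Real.exp (-T) := by
              rw [← Real.exp_add]; congr 1; ring

theorem IsIIDComplexGaussian.holeProb_le [IsProbabilityMeasure P] (hφ : IsIIDComplexGaussian P φ)
    (ha : IsCoeffFunction a) (hr : 0 < r) (hN : IsLastSignificant a r N)
    (hσ0 : 0 < σ) (hσ1 : σ ≤ 1)
    (htail : ∀ j : ℕ, Real.log (a (N + 1 + j : ℕ) * r ^ (N + 1 + j)) ≤ -(σ * j))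
    (hT : 1 ≤ bigS a r) (h0T : Real.log (a 0) ≤ bigS a r)
    (ha0 : 2 * bigS a r * a 0 < Real.exp (2 * bigS a r))
    (hM : (N + 1) * ((2 * bigS a r + N) * Real.exp (bigS a r)) +
      (2 * bigS a r + (N + 1)) * (8 / σ ^ 2) ≤ Real.exp (2 * bigS a r)) :
    holeProb P a φ r ≤ Real.exp (-(bigS a r - (1 + 2 * max (Real.log (a 0)) 0 +
      2 * N * Real.log (12 * (4 * bigS a r ^ 2 * a 0 + 1) * N)))) := by
  set T := bigS a r with hTdef
  have ha0' := ha.pos 0 le_rfl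
  have hN1 : (1 : ℝ) ≤ N := by exact_mod_cast hN.one_le
  have hpos : ∀ n : ℕ, 0 < a n * r ^ n := fun n => mul_pos (ha.pos n n.cast_nonneg) (pow_pos hr n)
  set D : ℝ := 12 * (4 * T ^ 2 * a 0 + 1) * N with hD
  have hD1 : 1 ≤ D := by
    have : 0 ≤ 4 * T ^ 2 * a 0 := by positivity
    rw [hD]
    nlinarith [mul_nonneg this (zero_le_one.trans hN1)]
  set C := max (Real.log (a 0)) 0 with hC
  have hC0 : 0 ≤ C := le_max_right _ _
  obtain ⟨hsum, htsum⟩ := summable_and_tsum_le ha hr hN hσ0 hσ1 htail (zero_le_one.trans hT)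
    le_rfl h0T
  set ctr : ℕ → (ℕ → ℂ) → ℂ := fun n u =>
    taylorCentre n (fun i => u i * (a i * r ^ i : ℝ)) / (a (n + 1 : ℕ) * r ^ (n + 1) : ℝ) with hctr
  set R : ℕ → ℝ := fun n => D / (a (n + 1 : ℕ) * r ^ (n + 1)) with hR
  have hR0 : ∀ n, 0 ≤ R n := fun n => div_nonneg (by linarith) (hpos _).le
  have hctrm : ∀ n, Measurable (ctr n) := fun n =>
    ((measurable_taylorCentre n).comp (measurable_pi_lambda _ fun i =>
      (measurable_pi_apply i).mul_const _)).div_const _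
  have hP := hφ.measure_forall_closedBall_le hctrm (fun n u v huv => by
    simp only [hctr]
    rw [taylorCentre_congr fun i hi => by rw [huv i hi]]) hR0 N
  have hprod : ∏ n ∈ Finset.range N, R n ^ 2 ≤ Real.exp (-(T - (2 * C + 2 * N * Real.log D))) := by
    have h1 : ∀ n ∈ Finset.range N, R n ^ 2 =
        Real.exp (2 * Real.log D - 2 * Real.log (a (n + 1 : ℕ) * r ^ (n + 1))) := by
      intro n _
      rw [hR, Real.exp_sub, two_mul, two_mul, Real.exp_add, Real.exp_add,
        Real.exp_log (by linarith), Real.exp_log (hpos _), div_pow, sq, sq]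
    rw [Finset.prod_congr rfl h1, ← Real.exp_sum]
    refine Real.exp_le_exp.2 ?_
    rw [Finset.sum_sub_distrib, Finset.sum_const, Finset.card_range, nsmul_eq_mul, ← Finset.mul_sum,
      ← sum_Icc_one_eq_sum_range (fun n => Real.log (a n * r ^ n)) N]
    have := ha.bigS_le_sum_Icc hr hN
    linarith
  have hsub : {ω | ∀ z : ℂ, ‖z‖ ≤ r → gaussianEntire a φ ω z ≠ 0} ⊆
      {ω | ∃ n : ℕ, 2 * T + n < ‖φ n ω‖} ∪
        {ω | ∀ n < N, ‖φ (n + 1) ω - ctr n (fun i => φ i ω)‖ ≤ R n} := by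
    intro ω hω
    by_cases hbad : ∃ n : ℕ, 2 * T + n < ‖φ n ω‖
    · exact Or.inl hbad
    · push Not at hbad
      exact Or.inr fun n hn => norm_sub_taylorCentre_div_le ha hr hsum (htsum.trans hM)
        (zero_le_one.trans hT) ha0 hbad hω hn
  have hlogD : 0 ≤ Real.log D := Real.log_nonneg hD1
  set X := 2 * C + 2 * N * Real.log D with hX
  have hX0 : 0 ≤ X := by positivity
  have hfin : P {ω | ∀ z : ℂ, ‖z‖ ≤ r → gaussianEntire a φ ω z ≠ 0} ≤
      ENNReal.ofReal (Real.exp (-(T - (1 + X)))) := by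
    calc P {ω | ∀ z : ℂ, ‖z‖ ≤ r → gaussianEntire a φ ω z ≠ 0}
        ≤ P {ω | ∃ n : ℕ, 2 * T + n < ‖φ n ω‖} +
          P {ω | ∀ n < N, ‖φ (n + 1) ω - ctr n (fun i => φ i ω)‖ ≤ R n} :=
          (measure_mono hsub).trans (measure_union_le _ _)
      _ ≤ ENNReal.ofReal (Real.exp (-T)) + ENNReal.ofReal (Real.exp (-(T - X))) :=
          add_le_add (hφ.measure_exists_norm_gt_le hT)
            (hP.trans (ENNReal.ofReal_le_ofReal hprod))
      _ ≤ ENNReal.ofReal (Real.exp (-(T - (1 + X)))) := by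
          rw [← ENNReal.ofReal_add (by positivity) (by positivity)]
          refine ENNReal.ofReal_le_ofReal ?_
          -- Both probabilities are at most `exp (-(T - X))`; the factor `2 ≤ e` accounts for the
          -- `1` in the exponent.
          have h1 : Real.exp (-T) ≤ Real.exp (-(T - X)) := Real.exp_le_exp.2 (by linarith)
          have h2 : Real.exp (-(T - (1 + X))) = Real.exp 1 * Real.exp (-(T - X)) := by
            rw [← Real.exp_add]; congr 1; ring
          have h3 : 2 ≤ Real.exp 1 := by linarith [Real.add_one_le_exp (1 : ℝ)]
          rw [h2]
          nlinarith [Real.exp_pos (-(T - X))]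
  rw [holeProb, Measure.real, show 1 + 2 * C + 2 * N * Real.log D = 1 + X by rw [hX]; ring]
  exact ENNReal.toReal_le_of_le_ofReal (by positivity) hfin

end HoleProbUpperBound

/-! ### Asymptotic comparison of the errors and conclusion. -/

theorem eventually_const_mul_rpow_le (C : ℝ) {p q : ℝ} (hpq : p < q) :
    ∀ᶠ T : ℝ in atTop, C * T ^ p ≤ T ^ q := by
  filter_upwards [(tendsto_rpow_atTop (sub_pos.2 hpq)).eventually_ge_atTop C,
    eventually_gt_atTop 0] with T hT hT0
  calc C * T ^ p ≤ T ^ (q - p) * T ^ p := by gcongr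
    _ = T ^ q := by rw [← Real.rpow_add hT0]; congr 1; ring

theorem eventually_const_mul_pow_le_exp (C : ℝ) (k : ℕ) :
    ∀ᶠ T : ℝ in atTop, C * T ^ k ≤ Real.exp T := by
  filter_upwards [(Real.tendsto_exp_div_pow_atTop k).eventually_ge_atTop C,
    eventually_gt_atTop 0] with T hT hT0
  rwa [le_div_iff₀ (by positivity)] at hT

/-- The asymptotic comparison of the error terms, for `N ^ 2 ≤ T ^ (1 + δ)`. -/
theorem eventually_error_bounds {A : ℝ} (hA : 0 < A) {δ : ℝ} (hδ : 0 < δ) (hδ1 : δ ≤ 1 / 10) :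
    ∀ᶠ T : ℝ in atTop, 1 ≤ T ∧ 4 * max (Real.log A) 0 ≤ T ∧ 2 * T * A < Real.exp (2 * T) ∧
      ∀ N : ℝ, 1 ≤ N → N ^ 2 ≤ T ^ (1 + δ) →
        (N + 1) * ((2 * T + N) * Real.exp T) + (2 * T + (N + 1)) * (8 / (T ^ (-δ) / 4) ^ 2) ≤
          Real.exp (2 * T) ∧
        (2 / A) ^ 2 + N * (1 + 2 * Real.log N) + 128 / (T ^ (-δ) / 4) ^ 3 ≤
          T ^ (1 / 2 + 10 * δ) ∧
        1 + 2 * max (Real.log A) 0 + 2 * N * Real.log (12 * (4 * T ^ 2 * A + 1) * N) ≤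
          T ^ (1 / 2 + 10 * δ) := by
  have hp : 1 / 2 + 3 / 2 * δ < 1 / 2 + 10 * δ := by linarith
  -- The factors `4` and `32` make each error contribution at most a quarter of `T ^ (1 / 2 + 10 *
  -- δ)`; `8192 = 128 * 4 ^ 3` comes from the tail cost `128 / σ ^ 3`.
  filter_upwards [eventually_ge_atTop 1, eventually_ge_atTop (4 * max (Real.log A) 0),
    eventually_ge_atTop (48 * A + 12), eventually_ge_atTop (520 : ℝ),
    eventually_const_mul_pow_le_exp (2 * A) 1, eventually_const_mul_pow_le_exp 2 3,
    (isLittleO_log_rpow_atTop hδ).bound one_pos,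
    eventually_const_mul_rpow_le (4 * (2 / A) ^ 2) (show (0 : ℝ) < 1 / 2 + 10 * δ by linarith),
    eventually_const_mul_rpow_le (4 * (1 + 2 * max (Real.log A) 0))
      (show (0 : ℝ) < 1 / 2 + 10 * δ by linarith),
    eventually_const_mul_rpow_le 32 hp,
    eventually_const_mul_rpow_le (4 * 8192) (show 3 * δ < 1 / 2 + 10 * δ by linarith)]
    with T hT1 hTC hTA hT520 hexp1 hexp3 hlog hc1 hc2 hc3 hc4
  have hT0 : 0 < T := by linarith
  have hE : Real.exp (2 * T) = Real.exp T * Real.exp T := by rw [← Real.exp_add]; congr 1; ring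
  have hE1 : 1 < Real.exp T := Real.one_lt_exp_iff.2 hT0
  rw [Real.rpow_zero, mul_one] at hc1 hc2
  refine ⟨hT1, hTC, ?_, fun N hN1 hN => ?_⟩
  · rw [hE]
    rw [pow_one] at hexp1
    linarith [mul_lt_mul_of_pos_right hE1 (Real.exp_pos T)]
  have hlogT : Real.log T ≤ T ^ δ := by
    rwa [Real.norm_of_nonneg (Real.log_nonneg hT1), Real.norm_of_nonneg (by positivity),
      one_mul] at hlog
  have hTδ1 : 1 ≤ T ^ δ := Real.one_le_rpow hT1 hδ.le
  have hNle : N ≤ T ^ (1 / 2 + 1 / 2 * δ) := by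
    refine (sq_le_sq₀ (by linarith) (by positivity)).1 (hN.trans (le_of_eq ?_))
    rw [← Real.rpow_natCast (T ^ _), ← Real.rpow_mul hT0.le]
    congr 1
    push_cast
    ring
  have hNT : N ≤ T := by
    refine hNle.trans ((Real.rpow_le_rpow_of_exponent_le hT1 ?_).trans_eq (Real.rpow_one T))
    linarith
  have hlogN : Real.log N ≤ T ^ δ := (Real.log_le_log (by linarith) hNT).trans hlogT
  have hNδ : N * T ^ δ ≤ T ^ (1 / 2 + 3 / 2 * δ) := by
    calc N * T ^ δ ≤ T ^ (1 / 2 + 1 / 2 * δ) * T ^ δ := by gcongr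
      _ = T ^ (1 / 2 + 3 / 2 * δ) := by rw [← Real.rpow_add hT0]; congr 1; ring
  have hinv : (T ^ (-δ) / 4)⁻¹ = 4 * T ^ δ := by
    rw [Real.rpow_neg hT0.le]; field_simp
  refine ⟨?_, ?_, ?_⟩
  · have h2 : 8 / (T ^ (-δ) / 4) ^ 2 ≤ 128 * T := by
      rw [div_eq_mul_inv, ← inv_pow, hinv, mul_pow]
      have : (T ^ δ) ^ 2 ≤ T := by
        rw [← Real.rpow_natCast (T ^ δ), ← Real.rpow_mul hT0.le]
        refine (Real.rpow_le_rpow_of_exponent_le hT1 ?_).trans_eq (Real.rpow_one T)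
        push_cast
        linarith
      linarith
    have h3 : (N + 1) * ((2 * T + N) * Real.exp T) ≤ (2 * T) * ((3 * T) * Real.exp T) := by
      gcongr <;> linarith
    have h4 : (2 * T + (N + 1)) * (8 / (T ^ (-δ) / 4) ^ 2) ≤ (4 * T) * (128 * T) := by
      gcongr
      linarith
    have h5 : 512 * T ^ 2 ≤ 512 * T ^ 2 * Real.exp T :=
      le_mul_of_one_le_right (by positivity) hE1.le
    have h6 : 518 * T ^ 2 ≤ Real.exp T := by
      refine le_trans ?_ hexp3
      linarith [mul_le_mul_of_nonneg_right hT520 (sq_nonneg T), sq_nonneg T]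
    rw [hE]
    linarith [mul_le_mul_of_nonneg_right h6 (Real.exp_pos T).le]
  · have h1 : N * (1 + 2 * Real.log N) ≤ 3 * T ^ (1 / 2 + 3 / 2 * δ) := by
      have : N * (1 + 2 * Real.log N) ≤ N * (3 * T ^ δ) := by gcongr; linarith
      linarith
    have h2 : 128 / (T ^ (-δ) / 4) ^ 3 = 8192 * T ^ (3 * δ) := by
      rw [div_eq_mul_inv, ← inv_pow, hinv, mul_pow, ← Real.rpow_natCast (T ^ δ),
        ← Real.rpow_mul hT0.le]
      push_cast
      rw [mul_comm δ 3]
      ring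
    have h3 : 0 ≤ T ^ (1 / 2 + 3 / 2 * δ) := by positivity
    rw [h2]
    linarith
  · have hlogD : Real.log (12 * (4 * T ^ 2 * A + 1) * N) ≤ 4 * T ^ δ := by
      have : 12 * (4 * T ^ 2 * A + 1) * N ≤ T ^ 4 := by
        have h1 : 12 * (4 * T ^ 2 * A + 1) ≤ T ^ 2 * (48 * A + 12) := by
          linarith [one_le_pow₀ hT1 (n := 2)]
        calc 12 * (4 * T ^ 2 * A + 1) * N ≤ (T ^ 2 * (48 * A + 12)) * N := by gcongr
          _ ≤ (T ^ 2 * T) * T := by gcongr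
          _ = T ^ 4 := by ring
      calc Real.log (12 * (4 * T ^ 2 * A + 1) * N) ≤ Real.log (T ^ 4) :=
            Real.log_le_log (by positivity) this
        _ ≤ 4 * T ^ δ := by
            rw [Real.log_pow]
            push_cast
            linarith
    have h1 : 2 * N * Real.log (12 * (4 * T ^ 2 * A + 1) * N) ≤ 8 * T ^ (1 / 2 + 3 / 2 * δ) := by
      have : 2 * N * Real.log (12 * (4 * T ^ 2 * A + 1) * N) ≤ 2 * N * (4 * T ^ δ) := by gcongr
      linarith
    have h3 : 0 ≤ T ^ (1 / 2 + 3 / 2 * δ) := by positivity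
    linarith

theorem theorem2 :
    ∃ c₁ c₂ : ℝ, 0 < c₁ ∧ 0 < c₂ ∧
      ∀ (α : ℝ) (a : ℝ → ℝ), 1 ≤ α → IsCoeffFunction a →
        (∀ᶠ t : ℝ in atTop, Real.exp (-(t * (Real.log t) ^ α)) ≤ a t) →
        ∀ ε : ℝ, 0 < ε → ∃ E : Set ℝ, FiniteLogMeasure E ∧
          ∀ (Ω : Type*) [MeasurableSpace Ω] (P : Measure Ω) [IsProbabilityMeasure P]
            (φ : ℕ → Ω → ℂ), IsIIDComplexGaussian P φ →
            ∀ r : ℝ, 1 ≤ r → r ∉ E →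
              0 < holeProb P a φ r ∧
              bigS a r - c₁ * bigS a r ^ ((0.9 : ℝ) + ε) ≤ negLogHoleProb P a φ r ∧
              negLogHoleProb P a φ r ≤ bigS a r + c₂ * bigS a r ^ ((0.5 : ℝ) + ε) := by
  refine ⟨1, 1, one_pos, one_pos, fun α a _ ha _ ε hε => ?_⟩
  -- Both errors are at most `T ^ (1 / 2 + 10 * δ)`, which `10 * δ ≤ ε` places below both required
  -- powers.
  obtain ⟨δ, hδ0, hδ1, hδε⟩ : ∃ δ : ℝ, 0 < δ ∧ δ ≤ 1 / 10 ∧ 10 * δ ≤ ε :=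
    ⟨min 1 ε / 10, by positivity, by linarith [min_le_left 1 ε], by linarith [min_le_right 1 ε]⟩
  obtain ⟨B, hB⟩ := eventually_atTop.1 (eventually_error_bounds (ha.pos 0 le_rfl) hδ0 hδ1)
  obtain ⟨E, hE, hgood⟩ := ha.exists_finiteLogMeasure hδ0 B
  refine ⟨E, hE, fun Ω _ P _ φ hφ r hr1 hrE => ?_⟩
  have hr : 0 < r := one_pos.trans_le hr1
  obtain ⟨hBS, N, hN, hNS⟩ := hgood r hr1 hrE
  obtain ⟨hT1, hTC, hTa, hNb⟩ := hB _ hBS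
  obtain ⟨hM, hup, hlow⟩ := hNb N (by exact_mod_cast hN.one_le) hNS
  set T := bigS a r with hT
  have hT0 : 0 < T := one_pos.trans_le hT1
  set σ := T ^ (-δ) / 4 with hσ
  have hσ0 : 0 < σ := by positivity
  have hσ1 : σ ≤ 1 := by
    have := Real.rpow_le_one_of_one_le_of_nonpos hT1 (neg_nonpos.2 hδ0.le)
    rw [hσ]
    linarith
  -- The `4` in `σ` makes the left side at most `T / 2`; the other half of `T` covers the index-`0`
  -- term.
  have hσN : 2 * (N : ℝ) ^ 2 * σ ≤ T - 2 * max (Real.log (a 0)) 0 := by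
    have : (N : ℝ) ^ 2 * T ^ (-δ) ≤ T := by
      calc (N : ℝ) ^ 2 * T ^ (-δ) ≤ T ^ (1 + δ) * T ^ (-δ) := by gcongr
        _ = T := by rw [← Real.rpow_add hT0, add_neg_cancel_right, Real.rpow_one]
    rw [hσ]
    linarith
  have htail := ha.log_term_le_neg_mul hr hN hσ0.le hσN
  have hlb := hφ.exp_neg_le_holeProb ha hr hN hσ0 hσ1 htail
  have hub := hφ.holeProb_le ha hr hN hσ0 hσ1 htail hT1
    (by linarith [le_max_left (Real.log (a 0)) 0, le_max_right (Real.log (a 0)) 0]) hTa hM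
  have hpos : 0 < holeProb P a φ r := (Real.exp_pos _).trans_le hlb
  have h1 : T ^ (1 / 2 + 10 * δ) ≤ T ^ ((0.9 : ℝ) + ε) :=
    Real.rpow_le_rpow_of_exponent_le hT1 (by norm_num; linarith)
  have h2 : T ^ (1 / 2 + 10 * δ) ≤ T ^ ((0.5 : ℝ) + ε) :=
    Real.rpow_le_rpow_of_exponent_le hT1 (by norm_num; linarith)
  have hlb' := (Real.le_log_iff_exp_le hpos).2 hlb
  have hub' := (Real.log_le_iff_le_exp hpos).2 hub
  refine ⟨hpos, ?_, ?_⟩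
  · rw [negLogHoleProb]
    linarith
  · rw [negLogHoleProb]
    linarith
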